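/- Let $\mathbb D=\{z\in\mathbb C:|z|<1\}$ and let $K,\delta$ be real numbers with $0\le\delta\le 2$ and $2\le K\le 4-\delta$. Let $h$ be analytic and locally univalent (locally injective) in $\mathbb D$, normalized by $h(0)=0$, $h'(0)=1$, and of boundary rotation at most $K\pi$, that is, $$\int_0^{2\pi}\left|\operatorname{Re}\left(1+\frac{re^{i\theta}h''(re^{i\theta})}{h'(re^{i\theta})}\right)\right|d\theta\le K\pi\qquad\text{for all } 0<r<1 .$$ Let $g$ be analytic in $\mathbb D$ with $g'(z)=\omega(z)h'(z)$ for $z\in\mathbb D$, where the dilatation $\omega$ satisfies $|\omega(z)|<\sin(\delta\pi/4)$ for all $z\in\mathbb D$. Then the harmonic mapping $f=h+\overline g$ is univalent (injective) in $\mathbb D$ and close-to-convex, i.e. the complement $\mathbb C\setminus f(\mathbb D)$ is a (possibly empty) union of closed half-lines with pairwise disjoint interiors, where the interior of a half-line is the half-line without its endpoint. -/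

import Mathlib

open Complex Set Metric Topology
open scoped Real ComplexConjugate

/-- `h` is locally univalent in the open unit disk: every point of the disk has a neighbourhood
on which `h` is injective. -/
def LocallyUnivalentOnDisk (h : ℂ → ℂ) : Prop :=
  ∀ z ∈ ball (0 : ℂ) 1, ∃ U ∈ 𝓝 z, InjOn h U

/-- The class `𝒱_K` of normalized, locally univalent analytic functions on the open unit disk
with boundary rotation at most `K π`. -/
structure BoundaryRotationClass (K : ℝ) (h : ℂ → ℂ) : Prop where
  analytic : AnalyticOnNhd ℂ h (ball 0 1)
  map_zero : h 0 = 0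
  deriv_zero : deriv h 0 = 1
  locallyUnivalent : LocallyUnivalentOnDisk h
  rotation_le : ∀ r : ℝ, 0 < r → r < 1 →
    ∫ θ in (0 : ℝ)..(2 * π),
      |(1 + (r * exp (θ * I)) * deriv (deriv h) (r * exp (θ * I)) /
          deriv h (r * exp (θ * I))).re| ≤ K * π

/-- The closed half-line with origin `a` and direction `v` (meant for `v ≠ 0`). -/
def closedHalfLine (a v : ℂ) : Set ℂ := {w | ∃ t : ℝ, 0 ≤ t ∧ w = a + t * v}

/-- The interior of that half-line: the half-line without its origin. -/
def openHalfLine (a v : ℂ) : Set ℂ := {w | ∃ t : ℝ, 0 < t ∧ w = a + t * v}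

/-- A plane set is close-to-convex if its complement is a union of closed half-lines with pairwise
disjoint interiors. A half-line is encoded by its origin and its unit direction vector, which it
determines uniquely. -/
def IsCloseToConvexSet (Ω : Set ℂ) : Prop :=
  ∃ S : Set (ℂ × ℂ),
    (∀ p ∈ S, ‖p.2‖ = 1) ∧
    Ωᶜ = ⋃ p ∈ S, closedHalfLine p.1 p.2 ∧
    ∀ p ∈ S, ∀ q ∈ S, p ≠ q → Disjoint (openHalfLine p.1 p.2) (openHalfLine q.1 q.2)

/-- A function on the open unit disk is univalent if it is injective there. -/
def IsUnivalentOnDisk (f : ℂ → ℂ) : Prop := InjOn f (ball 0 1)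

/-- A function on the open unit disk is close-to-convex if it is univalent with
close-to-convex range. -/
def IsCloseToConvexOnDisk (f : ℂ → ℂ) : Prop :=
  IsUnivalentOnDisk f ∧ IsCloseToConvexSet (f '' ball 0 1)

/-!
On the circle `|z| = r` the argument of the tangent `z h'(z) i` of the analytic part is a function
of `θ` whose total variation is at most `K π` and whose increment is `2 π`, so it stays within
`(K - 2) π / 4` of a nondecreasing angle. Denote that angle by `s θ + π / 2`. The dilatation bound
makes the tangent of `f = h + conj g` point strictly to the left of the direction `e^{i s(θ)}`.
Attach to each point `f(r e^{iθ})` the open ray in the direction `e^{i s(θ)}`: as `θ` increases,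
the lines carrying the rays sweep across a fixed point `q` in one direction only, so
`arg (q - f(r e^{iθ})) - s θ` crosses the multiples of `2 π` only downwards. Hence the curve winds
at most once around `q`, and `f` is injective by the argument principle; the points on the rays
have winding number zero, so the rays avoid the image of the disk `|z| ≤ r`; and every exterior
point lies on rays of exactly one direction. As `r → 1`, a limit of these directions assigns to
every point outside the image of the unit disk a ray that stays outside, in such a way that no two
rays cross transversally. The rays on a common line are then merged into maximal half-lines.
-/

section Crossing

theorem eventually_sub_mul_neg_of_hasDerivAt {φ : ℝ → ℝ} {c x : ℝ} (hφ : HasDerivAt φ c x)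
    (hx : φ x = 0) (hc : c < 0) : ∀ᶠ y in 𝓝[≠] x, (y - x) * φ y < 0 := by
  filter_upwards [(hasDerivAt_iff_tendsto_slope.1 hφ).eventually_lt_const hc] with y hslope
  rw [slope_def_field, hx, sub_zero] at hslope
  rw [mul_comm]
  exact mul_neg_iff.2 (div_neg_iff.1 hslope)

variable {φ : ℝ → ℝ} {c a b : ℝ}

theorem lt_of_forall_downcrossing (hφ : Continuous φ)
    (hcross : ∀ x, φ x = c → ∀ᶠ y in 𝓝[≠] x, (y - x) * (φ y - c) < 0)
    (ha : φ a ≤ c) (hab : a < b) : φ b < c := by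
  have hsub : Icc a b ⊆ {x | φ x ≤ c} := by
    refine IsClosed.Icc_subset_of_forall_mem_nhdsWithin
      ((isClosed_le hφ continuous_const).inter isClosed_Icc) ha fun x hx => ?_
    rcases (show φ x ≤ c from hx.1).lt_or_eq with hlt | heq
    · filter_upwards [(hφ.continuousAt.eventually_lt_const hlt).filter_mono nhdsWithin_le_nhds]
        with y hy using hy.le
    · filter_upwards [(hcross x heq).filter_mono (nhdsGT_le_nhdsNE x),
        self_mem_nhdsWithin] with y hy hxy
      exact (sub_neg.1 (neg_of_mul_neg_right hy (sub_pos.2 hxy).le)).le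
  refine (hsub (right_mem_Icc.2 hab.le)).lt_of_ne fun heq => ?_
  have hleft : ∀ᶠ y in 𝓝[<] b, (y - b) * (φ y - c) < 0 :=
    (hcross b heq).filter_mono (nhdsLT_le_nhdsNE b)
  obtain ⟨y, hy, hay, hyb⟩ := (hleft.and (Ioo_mem_nhdsLT hab)).exists
  exact hy.not_ge (mul_nonneg_of_nonpos_of_nonpos (sub_neg.2 hyb).le
    (sub_nonpos.2 (hsub ⟨hay.le, hyb.le⟩)))

theorem eq_of_forall_downcrossing (hφ : Continuous φ)
    (hcross : ∀ x, φ x = c → ∀ᶠ y in 𝓝[≠] x, (y - x) * (φ y - c) < 0)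
    (ha : φ a = c) (hb : φ b = c) : a = b := by
  rcases lt_trichotomy a b with hab | hab | hab
  · exact absurd hb (lt_of_forall_downcrossing hφ hcross ha.le hab).ne
  · exact hab
  · exact absurd ha (lt_of_forall_downcrossing hφ hcross hb.le hab).ne

theorem exists_int_mul_mem_uIcc {T x y : ℝ} (hT : 0 < T) (hxy : T ≤ |x - y|) :
    ∃ m : ℤ, m * T ∈ uIcc x y := by
  wlog hle : x ≤ y generalizing x y
  · rw [uIcc_comm]
    exact this (by rwa [abs_sub_comm]) (le_of_not_ge hle)
  obtain ⟨m, ⟨hm₁, hm₂⟩, -⟩ := existsUnique_sub_zsmul_mem_Ioc hT y 0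
  rw [abs_sub_comm, abs_of_nonneg (sub_nonneg.2 hle)] at hxy
  simp only [zsmul_eq_mul] at hm₁ hm₂
  rw [uIcc_of_le hle]
  exact ⟨m, by linarith, by linarith⟩

end Crossing

/-- `β` is a continuous argument of the nonvanishing curve `w`, and increases by `n` full turns over
each period: for a `2π`-periodic `w` this says that `w` winds `n` times around `0`. -/
structure IsArgLift (w : ℝ → ℂ) (n : ℤ) (β : ℝ → ℝ) : Prop where
  continuous : Continuous β
  ne_zero : ∀ θ, w θ ≠ 0
  norm_mul_exp : ∀ θ, ‖w θ‖ * exp (β θ * I) = w θ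
  add_period : ∀ θ, β (θ + 2 * π) = β θ + n * (2 * π)

namespace IsArgLift

variable {w w₁ w₂ : ℝ → ℂ} {n n₁ n₂ : ℤ} {β β₁ β₂ : ℝ → ℝ}

theorem congr (hβ : IsArgLift w₁ n β) (hw : ∀ θ, w₂ θ = w₁ θ) : IsArgLift w₂ n β := by
  rwa [funext hw]

theorem mul (h₁ : IsArgLift w₁ n₁ β₁) (h₂ : IsArgLift w₂ n₂ β₂) :
    IsArgLift (fun θ => w₁ θ * w₂ θ) (n₁ + n₂) fun θ => β₁ θ + β₂ θ where
  continuous := h₁.continuous.add h₂.continuous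
  ne_zero θ := mul_ne_zero (h₁.ne_zero θ) (h₂.ne_zero θ)
  norm_mul_exp θ := by
    conv_rhs => rw [← h₁.norm_mul_exp, ← h₂.norm_mul_exp]
    rw [norm_mul]
    push_cast
    rw [add_mul, Complex.exp_add]
    ring
  add_period θ := by
    rw [h₁.add_period, h₂.add_period]
    push_cast
    ring

theorem im_eq (hβ : IsArgLift w n β) (θ : ℝ) : (w θ).im = ‖w θ‖ * Real.sin (β θ) := by
  conv_lhs => rw [← hβ.norm_mul_exp, im_ofReal_mul, exp_ofReal_mul_I_im]

theorem add_int_mul_period (hβ : IsArgLift w n β) (θ : ℝ) (k : ℤ) :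
    β (θ + k * (2 * π)) = β θ + k * (n * (2 * π)) := by
  simpa using AddConstMapClass.map_add_zsmul
    (⟨β, hβ.add_period⟩ : AddConstMap ℝ ℝ (2 * π) (n * (2 * π))) θ k

theorem pos_iff (hβ : IsArgLift w n β) {θ : ℝ} :
    0 < (w θ).re ∧ (w θ).im = 0 ↔ ∃ m : ℤ, β θ = m * (2 * π) := by
  have hnorm : 0 < ‖w θ‖ := norm_pos_iff.2 (hβ.ne_zero θ)
  have hre : (w θ).re = ‖w θ‖ * Real.cos (β θ) := by
    conv_lhs => rw [← hβ.norm_mul_exp, re_ofReal_mul, exp_ofReal_mul_I_re]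
  rw [hre, hβ.im_eq, mul_pos_iff_of_pos_left hnorm, mul_eq_zero_iff_left hnorm.ne']
  constructor
  · rintro ⟨hcos, hsin⟩
    obtain ⟨m, hm⟩ := (Real.cos_eq_one_iff (β θ)).1
      ((Real.sin_eq_zero_iff_cos_eq.1 hsin).resolve_right fun h => by linarith)
    exact ⟨m, hm.symm⟩
  · rintro ⟨m, hm⟩
    have hcos : Real.cos (β θ) = 1 := (Real.cos_eq_one_iff _).2 ⟨m, hm.symm⟩
    exact ⟨hcos ▸ one_pos, Real.sin_eq_zero_iff_cos_eq.2 (.inl hcos)⟩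

theorem exists_pos (hβ : IsArgLift w n β) (hn : n ≠ 0) :
    ∃ θ, 0 < (w θ).re ∧ (w θ).im = 0 := by
  have hturn : 2 * π ≤ |β 0 - β (0 + 2 * π)| := by
    rw [hβ.add_period, sub_add_cancel_left, abs_neg, abs_mul, abs_of_pos Real.two_pi_pos]
    exact le_mul_of_one_le_left Real.two_pi_pos.le (by exact_mod_cast Int.one_le_abs hn)
  obtain ⟨m, hm⟩ := exists_int_mul_mem_uIcc Real.two_pi_pos hturn
  obtain ⟨θ, -, hθ⟩ := intermediate_value_uIcc hβ.continuous.continuousOn hm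
  exact ⟨θ, hβ.pos_iff.2 ⟨m, hθ⟩⟩

section Downcrossing

variable (hβ : IsArgLift w n β)
  (hw : ∀ θ, 0 < (w θ).re → (w θ).im = 0 → ∀ᶠ y in 𝓝[≠] θ, (y - θ) * (w y).im < 0)

include hβ hw

theorem eventually_downcrossing {m : ℤ} {θ : ℝ} (hθ : β θ = m * (2 * π)) :
    ∀ᶠ y in 𝓝[≠] θ, (y - θ) * (β y - m * (2 * π)) < 0 := by
  obtain ⟨hre, him⟩ := hβ.pos_iff.2 ⟨m, hθ⟩
  have hclose : ∀ᶠ y in 𝓝 θ, |β y - m * (2 * π)| < π := by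
    refine (hβ.continuous.sub continuous_const).abs.continuousAt.eventually_lt_const ?_
    simpa [hθ] using Real.pi_pos
  filter_upwards [hw θ hre him, hclose.filter_mono nhdsWithin_le_nhds, self_mem_nhdsWithin]
    with y hy hβy hne
  obtain ⟨hlo, hhi⟩ := abs_lt.1 hβy
  rw [hβ.im_eq, ← Real.sin_sub_int_mul_two_pi _ m, mul_left_comm] at hy
  replace hy := neg_of_mul_neg_right hy (norm_nonneg _)
  by_contra! hcon
  refine hy.not_ge ?_
  rcases lt_or_gt_of_ne hne with hlt | hgt
  · exact mul_nonneg_of_nonpos_of_nonpos (sub_neg.2 hlt).le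
      (Real.sin_nonpos_of_nonpos_of_neg_pi_le
        (nonpos_of_mul_nonneg_right hcon (sub_neg.2 hlt)) hlo.le)
  · exact mul_nonneg (sub_pos.2 hgt).le
      (Real.sin_nonneg_of_nonneg_of_le_pi (nonneg_of_mul_nonneg_right hcon (sub_pos.2 hgt)) hhi.le)

theorem neg_of_downcrossing {θ : ℝ} (hre : 0 < (w θ).re) (him : (w θ).im = 0) : n < 0 := by
  obtain ⟨m, hm⟩ := hβ.pos_iff.1 ⟨hre, him⟩
  have hlt := lt_of_forall_downcrossing hβ.continuous
    (fun _ => hβ.eventually_downcrossing hw) hm.le (lt_add_of_pos_right θ Real.two_pi_pos)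
  rw [hβ.add_period, hm, add_lt_iff_neg_left] at hlt
  exact_mod_cast neg_of_mul_neg_left hlt Real.two_pi_pos.le

theorem nonpos_of_downcrossing : n ≤ 0 := by
  by_contra! hn
  obtain ⟨θ, hre, him⟩ := hβ.exists_pos hn.ne'
  exact hn.asymm (hβ.neg_of_downcrossing hw hre him)

theorem eq_add_period_of_downcrossing (hn : n = -1) {θ₁ θ₂ : ℝ}
    (h₁ : 0 < (w θ₁).re ∧ (w θ₁).im = 0) (h₂ : 0 < (w θ₂).re ∧ (w θ₂).im = 0) :
    ∃ k : ℤ, θ₁ = θ₂ + k * (2 * π) := by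
  obtain ⟨m₁, hm₁⟩ := hβ.pos_iff.1 h₁
  obtain ⟨m₂, hm₂⟩ := hβ.pos_iff.1 h₂
  refine ⟨m₂ - m₁, eq_of_forall_downcrossing hβ.continuous
    (fun _ => hβ.eventually_downcrossing hw) hm₁ ?_⟩
  rw [hβ.add_int_mul_period, hm₂, hn]
  push_cast
  ring

end Downcrossing

end IsArgLift

theorem im_mul_exp_mul_I (z : ℂ) (α : ℝ) :
    (z * exp (α * I)).im = z.im * Real.cos α + z.re * Real.sin α := by
  rw [mul_im, exp_ofReal_mul_I_re, exp_ofReal_mul_I_im, add_comm]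

theorem mem_openHalfLine_exp_iff {a q : ℂ} {α : ℝ} :
    q ∈ openHalfLine a (exp (α * I)) ↔
      0 < ((q - a) * exp ((-α : ℝ) * I)).re ∧ ((q - a) * exp ((-α : ℝ) * I)).im = 0 := by
  have hexp : exp (α * I) * exp ((-α : ℝ) * I) = 1 := by
    rw [ofReal_neg, neg_mul, ← Complex.exp_add, add_neg_cancel, Complex.exp_zero]
  constructor
  · rintro ⟨t, ht, rfl⟩
    rw [add_sub_cancel_left, mul_assoc, hexp, mul_one]
    exact ⟨ht, ofReal_im t⟩
  · rintro ⟨hre, him⟩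
    have hreal : (q - a) * exp ((-α : ℝ) * I) = (((q - a) * exp ((-α : ℝ) * I)).re : ℂ) :=
      Complex.ext rfl him
    refine ⟨_, hre, ?_⟩
    rw [← hreal]
    linear_combination -(q - a) * hexp

/-- A plane curve `p` together with a nondecreasing direction angle `s` making one full turn per
period, such that the tangent of `p` always points to the left of the direction `exp (s θ * I)`.
The outward ray at `θ` is the half-line from `p θ` in this direction. -/
structure OutwardDirected (p : ℝ → ℂ) (s : ℝ → ℝ) : Prop where
  hasDerivAt : ∀ θ, ∃ v, HasDerivAt p v θ ∧ 0 < (v * exp ((-s θ : ℝ) * I)).im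
  continuous_angle : Continuous s
  monotone_angle : Monotone s
  angle_add : ∀ θ, s (θ + 2 * π) = s θ + 2 * π

/-- The coordinate of `q` in the frame that has its origin at `p θ` and its positive real axis
along the outward ray at `θ`. -/
noncomputable def rayCoord (p : ℝ → ℂ) (s : ℝ → ℝ) (q : ℂ) (θ : ℝ) : ℂ :=
  (q - p θ) * exp ((-s θ : ℝ) * I)

namespace OutwardDirected

variable {p : ℝ → ℂ} {s : ℝ → ℝ} {q : ℂ} {θ : ℝ}

theorem continuous (hp : OutwardDirected p s) : Continuous p :=
  continuous_iff_continuousAt.2 fun θ =>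
    let ⟨_, hv, _⟩ := hp.hasDerivAt θ
    hv.continuousAt

theorem continuous_rayCoord (hp : OutwardDirected p s) (q : ℂ) : Continuous (rayCoord p s q) := by
  have := hp.continuous
  have := hp.continuous_angle
  unfold rayCoord
  fun_prop

theorem eventually_sub_mul_im_neg (hp : OutwardDirected p s) (him : (rayCoord p s q θ).im = 0) :
    ∀ᶠ y in 𝓝[≠] θ, (y - θ) * ((q - p y) * exp ((-s θ : ℝ) * I)).im < 0 := by
  obtain ⟨v, hv, hpos⟩ := hp.hasDerivAt θ
  refine eventually_sub_mul_neg_of_hasDerivAt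
    (imCLM.hasFDerivAt.comp_hasDerivAt θ ((hv.const_sub q).mul_const _)) him ?_
  rw [imCLM_apply, neg_mul, neg_im]
  exact neg_neg_of_pos hpos

theorem sub_mul_sin_nonneg (hp : OutwardDirected p s) {y : ℝ} (hy : |s y - s θ| ≤ π) :
    0 ≤ (y - θ) * Real.sin (s y - s θ) := by
  obtain ⟨hlo, hhi⟩ := abs_le.1 hy
  rcases le_total θ y with hle | hle
  · exact mul_nonneg (sub_nonneg.2 hle)
      (Real.sin_nonneg_of_nonneg_of_le_pi (sub_nonneg.2 (hp.monotone_angle hle)) hhi)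
  · exact mul_nonneg_of_nonpos_of_nonpos (sub_nonpos.2 hle)
      (Real.sin_nonpos_of_nonpos_of_neg_pi_le (sub_nonpos.2 (hp.monotone_angle hle)) hlo)

-- Turning the frame forward with increasing angle only lowers the coordinate of `q` further.
theorem eventually_sub_mul_im_rayCoord_neg (hp : OutwardDirected p s)
    (hre : 0 < (rayCoord p s q θ).re) (him : (rayCoord p s q θ).im = 0) :
    ∀ᶠ y in 𝓝[≠] θ, (y - θ) * (rayCoord p s q y).im < 0 := by
  have hre' : ∀ᶠ y in 𝓝 θ, 0 < (rayCoord p s q y).re :=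
    (continuous_re.comp (hp.continuous_rayCoord q)).continuousAt.eventually_const_lt hre
  have hangle : ∀ᶠ y in 𝓝 θ, |s y - s θ| < π / 2 := by
    refine (hp.continuous_angle.sub continuous_const).abs.continuousAt.eventually_lt_const ?_
    simpa using Real.pi_pos
  filter_upwards [hp.eventually_sub_mul_im_neg him, hre'.filter_mono nhdsWithin_le_nhds,
    hangle.filter_mono nhdsWithin_le_nhds] with y hfixed hre' hangle
  have hrotate : (q - p y) * exp ((-s θ : ℝ) * I)
      = rayCoord p s q y * exp ((s y - s θ : ℝ) * I) := by
    rw [rayCoord, mul_assoc, ← Complex.exp_add, ← add_mul, ← ofReal_add]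
    ring_nf
  have hcos : 0 < Real.cos (s y - s θ) := Real.cos_pos_of_mem_Ioo (abs_lt.1 hangle)
  have hsin := hp.sub_mul_sin_nonneg (hangle.le.trans (by linarith [Real.pi_pos]))
  rw [hrotate, im_mul_exp_mul_I] at hfixed
  refine neg_of_mul_neg_left (b := Real.cos (s y - s θ)) ?_ hcos.le
  linarith [mul_nonneg hre'.le hsin]

theorem isArgLift_rayCoord (hp : OutwardDirected p s) {n : ℤ} {β : ℝ → ℝ}
    (hβ : IsArgLift (fun θ => q - p θ) n β) :
    IsArgLift (rayCoord p s q) (n + -1) fun θ => β θ + -s θ :=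
  hβ.mul (w₂ := fun θ => exp ((-s θ : ℝ) * I))
    { continuous := hp.continuous_angle.neg
      ne_zero := fun θ => Complex.exp_ne_zero _
      norm_mul_exp := fun θ => by rw [norm_exp_ofReal_mul_I, ofReal_one, one_mul]
      add_period := fun θ => by
        rw [hp.angle_add]
        push_cast
        ring }

theorem winding_le_one (hp : OutwardDirected p s) {n : ℤ} {β : ℝ → ℝ}
    (hβ : IsArgLift (fun θ => q - p θ) n β) : n ≤ 1 := by
  have := (hp.isArgLift_rayCoord hβ).nonpos_of_downcrossing
    fun _ => hp.eventually_sub_mul_im_rayCoord_neg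
  linarith

theorem winding_nonpos_of_mem_ray (hp : OutwardDirected p s) {n : ℤ} {β : ℝ → ℝ}
    (hβ : IsArgLift (fun θ => q - p θ) n β) (hq : q ∈ openHalfLine (p θ) (exp (s θ * I))) :
    n ≤ 0 := by
  obtain ⟨hre, him⟩ := mem_openHalfLine_exp_iff.1 hq
  have := (hp.isArgLift_rayCoord hβ).neg_of_downcrossing
    (fun _ => hp.eventually_sub_mul_im_rayCoord_neg) hre him
  linarith

theorem exists_mem_ray (hp : OutwardDirected p s) {n : ℤ} {β : ℝ → ℝ}
    (hβ : IsArgLift (fun θ => q - p θ) n β) (hn : n ≠ 1) :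
    ∃ θ, q ∈ openHalfLine (p θ) (exp (s θ * I)) := by
  obtain ⟨θ, hθ⟩ := (hp.isArgLift_rayCoord hβ).exists_pos (fun h => hn (by linarith))
  exact ⟨θ, mem_openHalfLine_exp_iff.2 hθ⟩

theorem ray_direction_unique (hp : OutwardDirected p s) {β : ℝ → ℝ}
    (hβ : IsArgLift (fun θ => q - p θ) 0 β) {θ₁ θ₂ : ℝ}
    (h₁ : q ∈ openHalfLine (p θ₁) (exp (s θ₁ * I)))
    (h₂ : q ∈ openHalfLine (p θ₂) (exp (s θ₂ * I))) : exp (s θ₁ * I) = exp (s θ₂ * I) := by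
  obtain ⟨k, hk⟩ := (hp.isArgLift_rayCoord hβ).eq_add_period_of_downcrossing
    (fun _ => hp.eventually_sub_mul_im_rayCoord_neg) (zero_add _)
    (mem_openHalfLine_exp_iff.1 h₁) (mem_openHalfLine_exp_iff.1 h₂)
  have hs : s θ₁ = s θ₂ + k * (2 * π) := by
    rw [hk]
    simpa using AddConstMapClass.map_add_zsmul
      (⟨s, hp.angle_add⟩ : AddConstMap ℝ ℝ (2 * π) (2 * π)) θ₂ k
  rw [Complex.exp_eq_exp_iff_exists_int]
  exact ⟨k, by rw [hs]; push_cast; ring⟩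

theorem eventually_exists_mem_ray (hp : OutwardDirected p s)
    (hq : q ∈ openHalfLine (p θ) (exp (s θ * I))) :
    ∀ᶠ q' in 𝓝 q, ∃ θ', q' ∈ openHalfLine (p θ') (exp (s θ' * I)) := by
  obtain ⟨hre, him⟩ := mem_openHalfLine_exp_iff.1 hq
  have hcross := hp.eventually_sub_mul_im_rayCoord_neg hre him
  have hcoord : Continuous fun x : ℂ × ℝ => rayCoord p s x.1 x.2 := by
    have := hp.continuous
    have := hp.continuous_angle
    unfold rayCoord
    fun_prop
  have hpos : ∀ᶠ x in 𝓝 q ×ˢ 𝓝 θ, 0 < (rayCoord p s x.1 x.2).re := by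
    rw [← nhds_prod_eq]
    exact (continuous_re.comp hcoord).continuousAt.eventually_const_lt hre
  obtain ⟨P, hP, R, hR, hPR⟩ := Filter.eventually_prod_iff.1 hpos
  obtain ⟨ε, hε, hball⟩ := Metric.eventually_nhds_iff_ball.1 hR
  rw [Real.ball_eq_Ioo] at hball
  obtain ⟨a, ha, hal, haθ⟩ := ((hcross.filter_mono (nhdsLT_le_nhdsNE θ)).and
    (Ioo_mem_nhdsLT (sub_lt_self θ hε))).exists
  obtain ⟨b, hb, hbθ, hbr⟩ := ((hcross.filter_mono (nhdsGT_le_nhdsNE θ)).and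
    (Ioo_mem_nhdsGT (lt_add_of_pos_right θ hε))).exists
  have hleft : ∀ᶠ q' in 𝓝 q, 0 < (rayCoord p s q' a).im :=
    (continuous_im.comp (hcoord.comp (.prodMk_left a))).continuousAt.eventually_const_lt
      (pos_of_mul_neg_right ha (sub_neg.2 haθ).le)
  have hright : ∀ᶠ q' in 𝓝 q, (rayCoord p s q' b).im < 0 :=
    (continuous_im.comp (hcoord.comp (.prodMk_left b))).continuousAt.eventually_lt_const
      (neg_of_mul_neg_right hb (sub_pos.2 hbθ).le)
  filter_upwards [hP, hleft, hright] with q' hP hleft hright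
  obtain ⟨y, ⟨hay, hyb⟩, hy⟩ := intermediate_value_Icc' (haθ.trans hbθ).le
    (continuous_im.comp (hp.continuous_rayCoord q')).continuousOn ⟨hright.le, hleft.le⟩
  exact ⟨y, mem_openHalfLine_exp_iff.2
    ⟨hPR hP (hball y ⟨hal.trans_le hay, hyb.trans_lt hbr⟩), hy⟩⟩

end OutwardDirected

/-- `u` vanishes at `a` with nonzero linear part `c * (z - a)`, up to an error of relative size less
than `1`: an isolated zero of index `1`, for which `u` need not be differentiable. -/
def IsPositiveZero (u : ℂ → ℂ) (a : ℂ) : Prop :=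
  ∃ c : ℂ, c ≠ 0 ∧ ∃ k < (1 : ℝ), ∀ᶠ z in 𝓝 a, ‖u z - c * (z - a)‖ ≤ k * ‖c * (z - a)‖

/-- The quotient of `u` by `z - a`, made continuous at `a` by damping the part of `u` beyond
`c * (z - a)` within distance `ε` of `a`. -/
noncomputable def dampedQuotient (u : ℂ → ℂ) (a c : ℂ) (ε : ℝ) (z : ℂ) : ℂ :=
  c + (u z - c * (z - a)) * (conj (z - a) / (max ‖z - a‖ ε : ℝ) ^ 2)

section DampedQuotient

variable {u : ℂ → ℂ} {a c z : ℂ} {ε k : ℝ}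

theorem continuousOn_dampedQuotient {s : Set ℂ} (hu : ContinuousOn u s) (hε : 0 < ε) :
    ContinuousOn (dampedQuotient u a c ε) s := by
  have hmax (z : ℂ) : ((max ‖z - a‖ ε : ℝ) : ℂ) ^ 2 ≠ 0 := by
    exact_mod_cast (pow_pos (lt_max_of_lt_right hε) 2).ne'
  have hfactor : Continuous fun z => conj (z - a) / (max ‖z - a‖ ε : ℝ) ^ 2 :=
    Continuous.div₀ (continuous_conj.comp (by fun_prop)) (by fun_prop) hmax
  exact continuousOn_const.add ((hu.sub (by fun_prop)).mul hfactor.continuousOn)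

theorem dampedQuotient_eq_div (hε : 0 < ε) (hz : ε ≤ ‖z - a‖) :
    dampedQuotient u a c ε z = u z / (z - a) := by
  have hza : z - a ≠ 0 := norm_pos_iff.1 (hε.trans_le hz)
  have hinv : conj (z - a) / (‖z - a‖ : ℂ) ^ 2 = (z - a)⁻¹ := by
    rw [inv_def, normSq_eq_norm_sq, ofReal_inv, ofReal_pow, div_eq_mul_inv]
  rw [dampedQuotient, max_eq_left hz, hinv]
  field_simp
  ring

theorem dampedQuotient_ne_zero (hε : 0 < ε) (hc : c ≠ 0) (hk : k < 1) (hz : ‖z - a‖ ≤ ε)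
    (hu : ‖u z - c * (z - a)‖ ≤ k * ‖c * (z - a)‖) : dampedQuotient u a c ε z ≠ 0 := by
  set t := ‖z - a‖ / ε with ht
  have ht0 : 0 ≤ t := by positivity
  have ht1 : t ≤ 1 := (div_le_one hε).2 hz
  have hbound : ‖(u z - c * (z - a)) * (conj (z - a) / (max ‖z - a‖ ε : ℝ) ^ 2)‖
      ≤ ‖c‖ * (k * t ^ 2) := by
    rw [max_eq_right hz, norm_mul, norm_div, RCLike.norm_conj, norm_pow, norm_real,
      Real.norm_of_nonneg hε.le]
    calc ‖u z - c * (z - a)‖ * (‖z - a‖ / ε ^ 2)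
        ≤ k * ‖c * (z - a)‖ * (‖z - a‖ / ε ^ 2) := by gcongr
      _ = ‖c‖ * (k * t ^ 2) := by rw [norm_mul, ht]; ring
  have hkt : k * t ^ 2 < 1 := by
    rcases ht0.eq_or_lt with h0 | hpos
    · rw [← h0]
      norm_num
    · calc k * t ^ 2 < 1 * t ^ 2 := by gcongr
        _ ≤ 1 := by rw [one_mul]; exact pow_le_one₀ ht0 ht1
  intro hzero
  rw [dampedQuotient, add_eq_zero_iff_eq_neg'] at hzero
  rw [hzero, norm_neg] at hbound
  exact (mul_lt_of_lt_one_right (norm_pos_iff.2 hc) hkt).not_ge hbound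

end DampedQuotient

namespace IsPositiveZero

variable {u v : ℂ → ℂ} {a : ℂ}

theorem congr (hu : IsPositiveZero u a) (huv : u =ᶠ[𝓝 a] v) : IsPositiveZero v a := by
  obtain ⟨c, hc, k, hk, hle⟩ := hu
  refine ⟨c, hc, k, hk, ?_⟩
  filter_upwards [hle, huv] with z hz heq
  rwa [← heq]

theorem mul (hu : IsPositiveZero u a) (hv : ContinuousAt v a) (hva : v a ≠ 0) :
    IsPositiveZero (fun z => u z * v z) a := by
  obtain ⟨c, hc, k, hk, hle⟩ := hu
  obtain ⟨k', hkk', hk'⟩ := exists_between hk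
  refine ⟨c * v a, mul_ne_zero hc hva, k', hk', ?_⟩
  have hcont : ContinuousAt (fun z => k * ‖v z‖ + ‖v z - v a‖) a := by fun_prop
  have hclose : ∀ᶠ z in 𝓝 a, k * ‖v z‖ + ‖v z - v a‖ < k' * ‖v a‖ := by
    refine hcont.eventually_lt_const ?_
    beta_reduce
    rw [sub_self, norm_zero, add_zero]
    exact mul_lt_mul_of_pos_right hkk' (norm_pos_iff.2 hva)
  filter_upwards [hle, hclose] with z hz hclose
  calc ‖u z * v z - c * v a * (z - a)‖
      = ‖(u z - c * (z - a)) * v z + c * (z - a) * (v z - v a)‖ := by congr 1; ring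
    _ ≤ ‖u z - c * (z - a)‖ * ‖v z‖ + ‖c * (z - a)‖ * ‖v z - v a‖ :=
      (norm_add_le _ _).trans_eq (by rw [norm_mul, norm_mul (c * (z - a))])
    _ ≤ k * ‖c * (z - a)‖ * ‖v z‖ + ‖c * (z - a)‖ * ‖v z - v a‖ := by gcongr
    _ = ‖c * (z - a)‖ * (k * ‖v z‖ + ‖v z - v a‖) := by ring
    _ ≤ ‖c * (z - a)‖ * (k' * ‖v a‖) := by gcongr
    _ = k' * ‖c * v a * (z - a)‖ := by simp only [norm_mul]; ring

theorem eventually_ne (hu : IsPositiveZero u a) : ∀ᶠ z in 𝓝[≠] a, u z ≠ 0 := by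
  obtain ⟨c, hc, k, hk, hle⟩ := hu
  filter_upwards [hle.filter_mono nhdsWithin_le_nhds, self_mem_nhdsWithin] with z hz hza hzero
  rw [hzero, zero_sub, norm_neg] at hz
  have hpos : 0 < ‖c * (z - a)‖ := norm_pos_iff.2 (mul_ne_zero hc (sub_ne_zero.2 hza))
  exact (mul_lt_of_lt_one_left hpos hk).not_ge hz

theorem exists_div {s W : Set ℂ} (ha : IsPositiveZero u a) (hu : ContinuousOn u s)
    (hW : W ∈ 𝓝 a) :
    ∃ v : ℂ → ℂ, ContinuousOn v s ∧ ∃ V ⊆ W, IsClosed V ∧ a ∈ V ∧ (∀ z ∈ V, v z ≠ 0) ∧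
      ∀ z ∉ V, v z = u z / (z - a) := by
  obtain ⟨c, hc, k, hk, hle⟩ := ha
  obtain ⟨ε, hε, hball⟩ := Metric.nhds_basis_closedBall.mem_iff.1 (Filter.inter_mem hle hW)
  refine ⟨dampedQuotient u a c ε, continuousOn_dampedQuotient hu hε, closedBall a ε,
    fun z hz => (hball hz).2, isClosed_closedBall, mem_closedBall_self hε.le, fun z hz => ?_,
    fun z hz => ?_⟩
  · exact dampedQuotient_ne_zero hε hc hk (mem_closedBall_iff_norm.1 hz) (hball hz).1
  · rw [mem_closedBall_iff_norm, not_le] at hz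
    exact dampedQuotient_eq_div hε hz.le

end IsPositiveZero

section ArgumentPrinciple

variable {r : ℝ} {u : ℂ → ℂ}

theorem exists_retraction_closedBall (hr : 0 < r) :
    ∃ ρ : C(ℂ, closedBall (0 : ℂ) r), ∀ z : closedBall (0 : ℂ) r, ρ z = z := by
  have := instTietzeExtensionClosedBall ℂ (0 : ℂ) hr
  obtain ⟨ρ, hρ⟩ := ContinuousMap.exists_restrict_eq isClosed_closedBall
    (ContinuousMap.id (closedBall (0 : ℂ) r))
  exact ⟨ρ, DFunLike.congr_fun hρ⟩

theorem exists_isArgLift_zero_of_ne_zero (hr : 0 < r) (hu : ContinuousOn u (closedBall 0 r))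
    (hne : ∀ z ∈ closedBall 0 r, u z ≠ 0) :
    ∃ β, IsArgLift (fun θ => u (circleMap 0 r θ)) 0 β := by
  obtain ⟨ρ, hρ⟩ := exists_retraction_closedBall hr
  have hρcircle (θ : ℝ) : (ρ (circleMap 0 r θ) : ℂ) = circleMap 0 r θ :=
    congrArg Subtype.val (hρ ⟨_, circleMap_mem_closedBall 0 hr.le θ⟩)
  let uρ : C(ℂ, ℂ) := ⟨fun z => u (ρ z), hu.domRestrict.comp ρ.continuous⟩
  have hne' (z : ℂ) : uρ z ≠ 0 := hne _ (ρ z).2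
  obtain ⟨L, ⟨-, hexp⟩, -⟩ :=
    isCoveringMapOn_exp.existsUnique_continuousMap_lifts uρ (exp_log (hne' 0)) hne'
  have hL (θ : ℝ) : exp (L (circleMap 0 r θ)) = u (circleMap 0 r θ) :=
    (congrFun hexp _).trans (congrArg u (hρcircle θ))
  refine ⟨fun θ => (L (circleMap 0 r θ)).im, by fun_prop, fun θ => ?_, fun θ => ?_, fun θ => ?_⟩
  · exact hL θ ▸ Complex.exp_ne_zero _
  · rw [← hL, norm_exp, ofReal_exp, ← Complex.exp_add, re_add_im]
  · rw [periodic_circleMap, Int.cast_zero, zero_mul, add_zero]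

theorem isArgLift_circleMap (hr : 0 < r) : IsArgLift (circleMap 0 r) 1 id where
  continuous := continuous_id
  ne_zero _ := circleMap_ne_center hr.ne'
  norm_mul_exp θ := by rw [norm_circleMap_zero, abs_of_pos hr, circleMap_zero, id]
  add_period θ := by simp only [id, Int.cast_one, one_mul]

theorem isArgLift_arg {w : ℝ → ℂ} (hw : Continuous w) (hslit : ∀ θ, w θ ∈ slitPlane)
    (hper : ∀ θ, w (θ + 2 * π) = w θ) : IsArgLift w 0 fun θ => (w θ).arg where
  continuous := continuous_iff_continuousAt.2 fun θ =>
    (continuousAt_arg (hslit θ)).comp hw.continuousAt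
  ne_zero θ := slitPlane_ne_zero (hslit θ)
  norm_mul_exp θ := norm_mul_exp_arg_mul_I (w θ)
  add_period θ := by rw [hper, Int.cast_zero, zero_mul, add_zero]

theorem exists_isArgLift_circleMap_sub {a : ℂ} (ha : a ∈ ball 0 r) :
    ∃ β, IsArgLift (fun θ => circleMap 0 r θ - a) 1 β := by
  have hr : 0 < r := pos_of_mem_ball ha
  have hslit (θ : ℝ) : 1 - a / circleMap 0 r θ ∈ slitPlane := by
    rw [sub_eq_add_neg]
    refine mem_slitPlane_of_norm_lt_one ?_
    rw [norm_neg, norm_div, norm_circleMap_zero, abs_of_pos hr, div_lt_one hr]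
    exact mem_ball_zero_iff.1 ha
  have hcont : Continuous fun θ => 1 - a / circleMap 0 r θ :=
    continuous_const.sub
      (continuous_const.div₀ (continuous_circleMap 0 r) fun _ => circleMap_ne_center hr.ne')
  have hlift := (isArgLift_circleMap hr).mul (isArgLift_arg hcont hslit fun θ => by
    rw [periodic_circleMap])
  refine ⟨_, hlift.congr fun θ => ?_⟩
  rw [mul_sub, mul_one, mul_div_cancel₀ _ (circleMap_ne_center hr.ne')]

theorem exists_isArgLift_card_zeros (hr : 0 < r) (Z : Finset ℂ)
    (hu : ContinuousOn u (closedBall 0 r)) (hZ : ∀ z ∈ closedBall 0 r, u z = 0 ↔ z ∈ Z)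
    (hZr : ∀ z ∈ Z, z ∈ ball 0 r) (hpos : ∀ z ∈ Z, IsPositiveZero u z) :
    ∃ β, IsArgLift (fun θ => u (circleMap 0 r θ)) Z.card β := by
  induction Z using Finset.induction_on generalizing u with
  | empty =>
    exact exists_isArgLift_zero_of_ne_zero hr hu fun z hz h =>
      Finset.notMem_empty z ((hZ z hz).1 h)
  | insert a Z haZ ih =>
    have har : a ∈ ball 0 r := hZr a (Finset.mem_insert_self a Z)
    have hZa : (Z : Set ℂ)ᶜ ∈ 𝓝 a := Z.finite_toSet.isClosed.isOpen_compl.mem_nhds haZ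
    obtain ⟨v, hv, V, hVsub, hV, haV, hvV, hdiv⟩ := (hpos a (Finset.mem_insert_self a Z)).exists_div
      hu (Filter.inter_mem hZa (isOpen_ball.mem_nhds har))
    have hne {z : ℂ} (hz : z ∉ V) : z ≠ a := fun h => hz (h ▸ haV)
    have hvZ (z : ℂ) (hz : z ∈ closedBall 0 r) : v z = 0 ↔ z ∈ Z := by
      by_cases hzV : z ∈ V
      · exact iff_of_false (hvV z hzV) (hVsub hzV).1
      · rw [hdiv z hzV, div_eq_zero_iff, hZ z hz, Finset.mem_insert, sub_eq_zero,
          or_iff_left (hne hzV), or_iff_right (hne hzV)]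
    have hvpos (z : ℂ) (hz : z ∈ Z) : IsPositiveZero v z := by
      have hzV : z ∉ V := fun h => (hVsub h).1 hz
      have hinv : ContinuousAt (fun z => (z - a)⁻¹) z :=
        (continuousAt_id.sub continuousAt_const).inv₀ (sub_ne_zero.2 (hne hzV))
      refine ((hpos z (Finset.mem_insert_of_mem hz)).mul hinv
        (inv_ne_zero (sub_ne_zero.2 (hne hzV)))).congr ?_
      filter_upwards [hV.isOpen_compl.mem_nhds hzV] with y hy
      rw [hdiv y hy, div_eq_mul_inv]
    obtain ⟨β, hβ⟩ := ih hv hvZ (fun z hz => hZr z (Finset.mem_insert_of_mem hz)) hvpos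
    obtain ⟨γ, hγ⟩ := exists_isArgLift_circleMap_sub har
    rw [Finset.card_insert_of_notMem haZ, Nat.cast_add, Nat.cast_one]
    refine ⟨_, (hβ.mul hγ).congr fun θ => ?_⟩
    have hθV : circleMap 0 r θ ∉ V := fun h => circleMap_notMem_ball 0 r θ (hVsub h).2
    rw [hdiv _ hθV, div_mul_cancel₀ _ (sub_ne_zero.2 (hne hθV))]

end ArgumentPrinciple

theorem openHalfLine_subset_closedHalfLine (a v : ℂ) : openHalfLine a v ⊆ closedHalfLine a v :=
  fun _ ⟨t, ht, hq⟩ => ⟨t, ht.le, hq⟩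

theorem closedHalfLine_subset_openHalfLine {a v q : ℂ} (hq : q ∈ openHalfLine a v) :
    closedHalfLine q v ⊆ openHalfLine a v := by
  obtain ⟨t, ht, rfl⟩ := hq
  rintro _ ⟨t', ht', rfl⟩
  exact ⟨t + t', add_pos_of_pos_of_nonneg ht ht', by push_cast; ring⟩

-- Cramer's rule for the coordinates of `x` with respect to `v` and `w`.
theorem im_conj_mul_smul_eq (x v w : ℂ) :
    ((conj v * w).im : ℂ) * x = (conj x * w).im * v - (conj x * v).im * w := by
  apply Complex.ext <;>
    simp only [mul_re, mul_im, sub_re, sub_im, conj_re, conj_im, ofReal_re, ofReal_im] <;> ring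

theorem disjoint_openHalfLine_iff {a b v w : ℂ} (hvw : (conj v * w).im ≠ 0) :
    Disjoint (openHalfLine a v) (openHalfLine b w) ↔
      ¬(0 < (conj (b - a) * w).im / (conj v * w).im ∧
        0 < (conj (b - a) * v).im / (conj v * w).im) := by
  rw [← not_iff_not, not_not, Set.not_disjoint_iff]
  constructor
  · rintro ⟨q, ⟨t, ht, rfl⟩, t', ht', heq⟩
    have hab : b - a = t * v - t' * w := by linear_combination -heq
    have hw : (conj (b - a) * w).im = t * (conj v * w).im := by
      simp only [hab, map_sub, map_mul, conj_ofReal, mul_re, mul_im, sub_re, sub_im, conj_re,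
        conj_im, ofReal_re, ofReal_im]
      ring
    have hv : (conj (b - a) * v).im = t' * (conj v * w).im := by
      simp only [hab, map_sub, map_mul, conj_ofReal, mul_re, mul_im, sub_re, sub_im, conj_re,
        conj_im, ofReal_re, ofReal_im]
      ring
    rw [hw, hv, mul_div_cancel_right₀ _ hvw, mul_div_cancel_right₀ _ hvw]
    exact ⟨ht, ht'⟩
  · rintro ⟨ht, ht'⟩
    refine ⟨_, ⟨_, ht, rfl⟩, _, ht', ?_⟩
    have hne : ((conj v * w).im : ℂ) ≠ 0 := ofReal_ne_zero.2 hvw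
    rw [ofReal_div, ofReal_div]
    refine mul_left_cancel₀ hne ?_
    linear_combination v * mul_div_cancel₀ ((conj (b - a) * w).im : ℂ) hne
      - w * mul_div_cancel₀ ((conj (b - a) * v).im : ℂ) hne - im_conj_mul_smul_eq (b - a) v w

/-- A direction for each point off `Ω`, such that the half-lines in these directions avoid `Ω` and
cross each other only if they are parallel. Parallel half-lines may overlap, even in opposite
directions: unlike disjointness, this condition survives limits. -/
structure IsRayField (Ω : Set ℂ) (d : ℂ → ℂ) : Prop where
  norm_eq_one : ∀ w ∉ Ω, ‖d w‖ = 1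
  closedHalfLine_subset : ∀ w ∉ Ω, closedHalfLine w (d w) ⊆ Ωᶜ
  disjoint : ∀ w ∉ Ω, ∀ w' ∉ Ω, (conj (d w) * d w').im ≠ 0 →
    Disjoint (openHalfLine w (d w)) (openHalfLine w' (d w'))

section Limit

variable {ι : Type*} {l : Filter ι} {Ωs : ι → Set ℂ} {Ω : Set ℂ}

theorem IsRayField.of_tendsto [l.NeBot] {D : ι → ℂ → ℂ} {d : ℂ → ℂ}
    (hD : ∀ᶠ i in l, IsRayField (Ωs i) (D i)) (hsub : ∀ᶠ i in l, Ωs i ⊆ Ω)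
    (hexhaust : ∀ w ∈ Ω, ∀ᶠ x in l ×ˢ 𝓝 w, x.2 ∈ Ωs x.1)
    (hlim : ∀ w ∉ Ω, Filter.Tendsto (fun i => D i w) l (𝓝 (d w))) : IsRayField Ω d where
  norm_eq_one w hw := by
    refine tendsto_nhds_unique ((hlim w hw).norm) (tendsto_const_nhds.congr' ?_)
    filter_upwards [hD, hsub] with i hDi hi
    exact (hDi.norm_eq_one w fun h => hw (hi h)).symm
  closedHalfLine_subset w hw := by
    rintro _ ⟨t, ht, rfl⟩ hmem
    have hpoint : Filter.Tendsto (fun i => (i, w + t * D i w)) l (l ×ˢ 𝓝 (w + t * d w)) :=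
      Filter.tendsto_id.prodMk (((hlim w hw).const_mul _).const_add _)
    obtain ⟨i, hDi, hi, hit⟩ := (hD.and (hsub.and (hpoint.eventually (hexhaust _ hmem)))).exists
    exact (hDi.closedHalfLine_subset w fun h => hw (hi h)) ⟨t, ht, rfl⟩ hit
  disjoint w hw w' hw' hne := by
    have hconj (z : ℂ) : ContinuousAt conj z := continuous_conj.continuousAt
    have him {F : ι → ℂ} {z : ℂ} (hF : Filter.Tendsto F l (𝓝 z)) :
        Filter.Tendsto (fun i => (F i).im) l (𝓝 z.im) := (continuous_im.tendsto z).comp hF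
    have hden := him (((hconj _).tendsto.comp (hlim w hw)).mul (hlim w' hw'))
    have hnum := (him ((hlim w' hw').const_mul (conj (w' - w)))).div hden hne
    have hnum' := (him ((hlim w hw).const_mul (conj (w' - w)))).div hden hne
    rw [disjoint_openHalfLine_iff hne]
    rintro ⟨hpos, hpos'⟩
    obtain ⟨i, hDi, hi, hnei, hposi, hposi'⟩ := (hD.and (hsub.and ((hden.eventually_ne hne).and
      ((hnum.eventually_const_lt hpos).and (hnum'.eventually_const_lt hpos'))))).exists
    exact (disjoint_openHalfLine_iff hnei).1
      (hDi.disjoint w (fun h => hw (hi h)) w' (fun h => hw' (hi h)) hnei) ⟨hposi, hposi'⟩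

theorem exists_isRayField_of_exhaustion [l.NeBot]
    (hfield : ∀ᶠ i in l, ∃ D, IsRayField (Ωs i) D) (hsub : ∀ᶠ i in l, Ωs i ⊆ Ω)
    (hexhaust : ∀ w ∈ Ω, ∀ᶠ x in l ×ˢ 𝓝 w, x.2 ∈ Ωs x.1) : ∃ d, IsRayField Ω d := by
  obtain ⟨D, hD⟩ := Filter.skolem.1 hfield
  have hUl : (Ultrafilter.of l : Filter ι) ≤ l := Ultrafilter.of_le l
  have hlim (w : ℂ) (hw : w ∉ Ω) :
      ∃ v, Filter.Tendsto (fun i => D i w) (Ultrafilter.of l) (𝓝 v) := by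
    have hsphere : ∀ᶠ i in (Ultrafilter.of l : Filter ι), D i w ∈ sphere (0 : ℂ) 1 := by
      filter_upwards [hUl hD, hUl hsub] with i hDi hi
      exact mem_sphere_zero_iff_norm.2 (hDi.norm_eq_one w fun h => hw (hi h))
    obtain ⟨v, -, hv⟩ := (isCompact_sphere (0 : ℂ) 1).ultrafilter_le_nhds
      ((Ultrafilter.of l).map fun i => D i w) (Filter.le_principal_iff.2 hsphere)
    exact ⟨v, hv⟩
  choose! d hd using hlim
  exact ⟨d, .of_tendsto (hUl hD) (hUl hsub)
    (fun w hw => Filter.prod_mono_left _ hUl (hexhaust w hw)) hd⟩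

end Limit

/-- A sense-preserving, not necessarily smooth map of the unit disk that takes every concentric
circle to a curve with outward rays. The condition `map_nhds` says that `f` is continuous and open
at `a`. -/
structure HasOutwardCircles (f : ℂ → ℂ) : Prop where
  map_nhds : ∀ a ∈ ball (0 : ℂ) 1, Filter.map f (𝓝 a) = 𝓝 (f a)
  isPositiveZero : ∀ a ∈ ball (0 : ℂ) 1, IsPositiveZero (fun z => f z - f a) a
  directed : ∀ r : ℝ, 0 < r → r < 1 → ∃ s, OutwardDirected (fun θ => f (circleMap 0 r θ)) s

namespace HasOutwardCircles

variable {f : ℂ → ℂ} {r : ℝ} {q : ℂ}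

theorem continuousOn (hf : HasOutwardCircles f) : ContinuousOn f (ball 0 1) :=
  continuousOn_of_forall_continuousAt fun a ha => (hf.map_nhds a ha).le

theorem finite_fiber (hf : HasOutwardCircles f) (hr1 : r < 1) (q : ℂ) :
    (closedBall (0 : ℂ) r ∩ f ⁻¹' {q}).Finite := by
  by_contra hinf
  obtain ⟨a, ha, hacc⟩ := Set.Infinite.exists_accPt_of_subset_isCompact hinf
    (isCompact_closedBall (0 : ℂ) r) inter_subset_left
  have hclosed : IsClosed (closedBall (0 : ℂ) r ∩ f ⁻¹' {q}) :=
    (hf.continuousOn.mono (closedBall_subset_ball hr1)).preimage_isClosed_of_isClosed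
      isClosed_closedBall isClosed_singleton
  have hfa : f a = q := (hclosed.closure_subset (mem_closure_iff_clusterPt.2 hacc.clusterPt)).2
  obtain ⟨z, hz, hne⟩ := ((accPt_iff_frequently_nhdsNE.1 hacc).and_eventually
    (hf.isPositiveZero a (closedBall_subset_ball hr1 ha)).eventually_ne).exists
  exact hne (by rw [hz.2, hfa, sub_self])

theorem exists_isArgLift (hf : HasOutwardCircles f) (hr : 0 < r) (hr1 : r < 1)
    (hq : q ∉ f '' sphere 0 r) :
    ∃ β, IsArgLift (fun θ => q - f (circleMap 0 r θ)) (closedBall 0 r ∩ f ⁻¹' {q}).ncard β := by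
  have hfin := hf.finite_fiber hr1 q
  rw [ncard_eq_toFinset_card _ hfin]
  have hmem (z : ℂ) : z ∈ hfin.toFinset ↔ z ∈ closedBall 0 r ∧ f z = q := by
    rw [hfin.mem_toFinset, mem_inter_iff, mem_preimage, mem_singleton_iff]
  have hball : closedBall (0 : ℂ) r ⊆ ball 0 1 := closedBall_subset_ball hr1
  refine exists_isArgLift_card_zeros (u := fun z => q - f z) hr hfin.toFinset
    (continuousOn_const.sub (hf.continuousOn.mono hball)) (fun z hz => ?_) (fun z hz => ?_)
    fun z hz => ?_
  · rw [hmem, and_iff_right hz, sub_eq_zero, eq_comm]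
  · obtain ⟨hz, hfz⟩ := (hmem z).1 hz
    exact lt_of_le_of_ne hz fun h => hq ⟨z, h, hfz⟩
  · obtain ⟨hzr, rfl⟩ := (hmem z).1 hz
    refine ((hf.isPositiveZero z (hball hzr)).mul (v := fun _ => -1) continuousAt_const
      (neg_ne_zero.2 one_ne_zero)).congr (.of_eq (funext fun y => ?_))
    ring

theorem exists_isArgLift_zero (hf : HasOutwardCircles f) (hr : 0 < r) (hr1 : r < 1)
    (hq : q ∉ f '' closedBall 0 r) : ∃ β, IsArgLift (fun θ => q - f (circleMap 0 r θ)) 0 β := by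
  have hfiber : closedBall 0 r ∩ f ⁻¹' {q} = ∅ :=
    eq_empty_iff_forall_notMem.2 fun z hz => hq ⟨z, hz.1, hz.2⟩
  have := hf.exists_isArgLift hr hr1 (fun h => hq (image_mono sphere_subset_closedBall h))
  rwa [hfiber, ncard_empty] at this

theorem injOn (hf : HasOutwardCircles f) : InjOn f (ball 0 1) := by
  intro z₁ h₁ z₂ h₂ heq
  rw [mem_ball_zero_iff] at h₁ h₂
  obtain ⟨R, hR, hR1⟩ := exists_between (max_lt h₁ h₂)
  obtain ⟨r, ⟨hr, hrR⟩, hr_avoid⟩ :=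
    ((Ioo_infinite hR).sdiff ((hf.finite_fiber hR1 (f z₁)).image norm)).nonempty
  obtain ⟨h₁r, h₂r⟩ := max_lt_iff.1 hr
  have hr0 : 0 < r := (norm_nonneg z₁).trans_lt h₁r
  obtain ⟨s, hs⟩ := hf.directed r hr0 (hrR.trans hR1)
  obtain ⟨β, hβ⟩ := hf.exists_isArgLift hr0 (hrR.trans hR1) (q := f z₁) (by
    rintro ⟨z, hz, hfz⟩
    rw [mem_sphere_zero_iff_norm] at hz
    exact hr_avoid ⟨z, ⟨mem_closedBall_zero_iff.2 (hz.trans_le hrR.le), hfz⟩, hz⟩)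
  exact (ncard_le_one (hf.finite_fiber (hrR.trans hR1) _)).1 (mod_cast hs.winding_le_one hβ)
    z₁ ⟨mem_closedBall_zero_iff.2 h₁r.le, rfl⟩ z₂ ⟨mem_closedBall_zero_iff.2 h₂r.le, heq.symm⟩

-- Otherwise a ray would meet the image of the open disk, whose points have winding number one.
theorem notMem_image_of_mem_ray (hf : HasOutwardCircles f) (hr : 0 < r) (hr1 : r < 1) {s : ℝ → ℝ}
    (hs : OutwardDirected (fun θ => f (circleMap 0 r θ)) s) {θ : ℝ}
    (hq : q ∈ openHalfLine (f (circleMap 0 r θ)) (exp (s θ * I))) : q ∉ f '' closedBall 0 r := by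
  rintro ⟨z, hz, rfl⟩
  have hball : closedBall (0 : ℂ) r ⊆ ball 0 1 := closedBall_subset_ball hr1
  have hev := (hf.continuousOn.continuousAt (isOpen_ball.mem_nhds (hball hz))).eventually
    (hs.eventually_exists_mem_ray hq)
  rw [← closure_ball _ hr.ne'] at hz
  obtain ⟨z', hz', θ', hq'⟩ := ((mem_closure_iff_frequently.1 hz).and_eventually hev).exists
  obtain ⟨β, hβ⟩ := hf.exists_isArgLift hr hr1 (q := f z') (by
    rintro ⟨y, hy, hfy⟩
    rw [hf.injOn (hball (sphere_subset_closedBall hy)) (hball (ball_subset_closedBall hz')) hfy]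
      at hy
    exact ne_of_lt hz' hy)
  have hcard : (closedBall 0 r ∩ f ⁻¹' {f z'}).ncard = 0 :=
    Nat.le_zero.1 (mod_cast hs.winding_nonpos_of_mem_ray hβ hq')
  rw [ncard_eq_zero (hf.finite_fiber hr1 _)] at hcard
  exact hcard.subset ⟨ball_subset_closedBall hz', rfl⟩

theorem isOpen_image (hf : HasOutwardCircles f) {U : Set ℂ} (hU : IsOpen U)
    (hU1 : U ⊆ ball 0 1) : IsOpen (f '' U) := by
  rw [isOpen_iff_mem_nhds]
  rintro _ ⟨z, hz, rfl⟩
  rw [← hf.map_nhds z (hU1 hz)]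
  exact Filter.image_mem_map (hU.mem_nhds hz)

theorem exists_isRayField_closedBall (hf : HasOutwardCircles f) (hr : 0 < r) (hr1 : r < 1) :
    ∃ D, IsRayField (f '' closedBall 0 r) D := by
  obtain ⟨s, hs⟩ := hf.directed r hr hr1
  have hray (q : ℂ) (hq : q ∉ f '' closedBall 0 r) :
      ∃ θ, q ∈ openHalfLine (f (circleMap 0 r θ)) (exp (s θ * I)) := by
    obtain ⟨β, hβ⟩ := hf.exists_isArgLift_zero hr hr1 hq
    exact hs.exists_mem_ray hβ zero_ne_one
  choose! θ hθ using hray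
  refine ⟨fun q => exp (s (θ q) * I), fun q _ => norm_exp_ofReal_mul_I _, fun q hq q' hq' => ?_,
    fun q hq q' hq' hne => disjoint_left.2 fun x hx hx' => hne ?_⟩
  · exact hf.notMem_image_of_mem_ray hr hr1 hs
      (closedHalfLine_subset_openHalfLine (hθ q hq) hq')
  · have hx := closedHalfLine_subset_openHalfLine (hθ q hq)
      (openHalfLine_subset_closedHalfLine _ _ hx)
    have hx' := closedHalfLine_subset_openHalfLine (hθ q' hq')
      (openHalfLine_subset_closedHalfLine _ _ hx')
    obtain ⟨β, hβ⟩ := hf.exists_isArgLift_zero hr hr1 (hf.notMem_image_of_mem_ray hr hr1 hs hx)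
    rw [hs.ray_direction_unique hβ hx hx', mul_comm, mul_conj, ofReal_im]

theorem exists_isRayField (hf : HasOutwardCircles f) : ∃ d, IsRayField (f '' ball 0 1) d := by
  have hlt : ∀ᶠ r in 𝓝[<] (1 : ℝ), r ∈ Ioo 0 1 := Ioo_mem_nhdsLT one_pos
  refine exists_isRayField_of_exhaustion (l := 𝓝[<] (1 : ℝ)) (Ωs := fun r => f '' closedBall 0 r)
    (hlt.mono fun r hr => hf.exists_isRayField_closedBall hr.1 hr.2)
    (hlt.mono fun r hr => image_mono (closedBall_subset_ball hr.2)) ?_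
  rintro _ ⟨z, hz, rfl⟩
  obtain ⟨R, hzR, hR1⟩ := exists_between (mem_ball_zero_iff.1 hz)
  have hopen := hf.isOpen_image isOpen_ball (ball_subset_ball (x := (0 : ℂ)) hR1.le)
  filter_upwards [Filter.prod_mem_prod (Ioo_mem_nhdsLT hR1)
    (hopen.mem_nhds ⟨z, mem_ball_zero_iff.2 hzR, rfl⟩)] with x hx
  exact image_mono ((ball_subset_ball hx.1.1.le).trans ball_subset_closedBall) hx.2

end HasOutwardCircles

theorem closedHalfLine_subset_closure_openHalfLine (a v : ℂ) :
    closedHalfLine a v ⊆ closure (openHalfLine a v) := by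
  rintro _ ⟨t, ht, rfl⟩
  have hcont : Continuous fun t : ℝ => a + t * v := by fun_prop
  refine map_mem_closure (f := fun t : ℝ => a + t * v) (s := Ioi 0) hcont ?_
    fun t' ht' => ⟨t', ht', rfl⟩
  rwa [closure_Ioi]

/-- The point at position `x` on the line with direction `u` and signed distance `y` from the
origin (for `‖u‖ = 1`). Reversing the line negates all three of `u`, `y` and `x`. -/
noncomputable def linePoint (u : ℂ) (y x : ℝ) : ℂ := (x + y * I) * u

theorem linePoint_neg (u : ℂ) (y x : ℝ) : linePoint (-u) (-y) (-x) = linePoint u y x := by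
  simp only [linePoint, ofReal_neg]
  ring

theorem mem_closedHalfLine_linePoint {u : ℂ} {y x α : ℝ} (h : α ≤ x) :
    linePoint u y x ∈ closedHalfLine (linePoint u y α) u :=
  ⟨x - α, sub_nonneg.2 h, by simp only [linePoint, ofReal_sub]; ring⟩

theorem mem_openHalfLine_linePoint {u : ℂ} {y x α : ℝ} (h : α < x) :
    linePoint u y x ∈ openHalfLine (linePoint u y α) u :=
  ⟨x - α, sub_pos.2 h, by simp only [linePoint, ofReal_sub]; ring⟩

theorem exists_eq_linePoint_of_mem_openHalfLine {u z : ℂ} {y α : ℝ}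
    (hz : z ∈ openHalfLine (linePoint u y α) u) : ∃ x, α < x ∧ z = linePoint u y x := by
  obtain ⟨t, ht, rfl⟩ := hz
  exact ⟨α + t, lt_add_of_pos_right α ht, by simp only [linePoint, ofReal_add]; ring⟩

theorem conj_mul_linePoint {u : ℂ} (hu : ‖u‖ = 1) (y x : ℝ) :
    conj u * linePoint u y x = x + y * I := by
  have hunit : conj u * u = 1 := by rw [conj_mul', hu, ofReal_one, one_pow]
  rw [linePoint]
  linear_combination (x + y * I) * hunit

theorem linePoint_injective {u : ℂ} (hu : ‖u‖ = 1) {y x y' x' : ℝ}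
    (h : linePoint u y x = linePoint u y' x') : y = y' ∧ x = x' := by
  have heq := congrArg (conj u * ·) h
  simp only [conj_mul_linePoint hu] at heq
  have hre := congrArg re heq
  have him := congrArg im heq
  simp only [add_re, ofReal_re, re_ofReal_mul, I_re, mul_zero, add_zero] at hre
  simp only [add_im, ofReal_im, im_ofReal_mul, I_im, mul_one, zero_add] at him
  exact ⟨him, hre⟩

theorem exists_eq_linePoint {u : ℂ} (hu : ‖u‖ = 1) (w : ℂ) : ∃ y x, w = linePoint u y x := by
  have hunit : conj u * u = 1 := by rw [conj_mul', hu, ofReal_one, one_pow]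
  refine ⟨(conj u * w).im, (conj u * w).re, ?_⟩
  rw [linePoint, re_add_im]
  linear_combination -w * hunit

theorem eq_or_eq_neg_of_im_conj_mul_eq_zero {u v : ℂ} (hu : ‖u‖ = 1) (hv : ‖v‖ = 1)
    (h : (conj u * v).im = 0) : v = u ∨ v = -u := by
  obtain ⟨y, x, rfl⟩ := exists_eq_linePoint hu v
  obtain rfl : y = 0 := by
    simpa only [conj_mul_linePoint hu, add_im, ofReal_im, im_ofReal_mul, I_im, mul_one,
      zero_add] using h
  rw [linePoint, ofReal_zero, zero_mul, add_zero] at hv ⊢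
  rw [norm_mul, hu, mul_one, norm_real, Real.norm_eq_abs] at hv
  rcases (abs_eq one_pos.le).1 hv with rfl | rfl
  · exact .inl (by rw [ofReal_one, one_mul])
  · exact .inr (by rw [ofReal_neg, ofReal_one, neg_one_mul])

section MaximalHalfLines

variable {Ω : Set ℂ} {d : ℂ → ℂ} {u : ℂ} {y x α : ℝ}

/-- The positions on a line of the origins of those half-lines of the field `d` off `Ω` that run
along the line in its direction `u`. -/
def rayOrigins (Ω : Set ℂ) (d : ℂ → ℂ) (u : ℂ) (y : ℝ) : Set ℝ :=
  {x | linePoint u y x ∉ Ω ∧ d (linePoint u y x) = u}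

/-- The point at position `x` lies in the interior of a half-line of the field that runs along the
line in one of its two directions. -/
def IsCovered (Ω : Set ℂ) (d : ℂ → ℂ) (u : ℂ) (y x : ℝ) : Prop :=
  (∃ a ∈ rayOrigins Ω d u y, a < x) ∨ ∃ a ∈ rayOrigins Ω d (-u) (-y), a < -x

/-- `α` is the position of the origin of the half-line with direction `u` formed by the half-lines
of the field along a line in this direction; a line covered completely is instead cut at position
`0` into two half-lines. -/
def IsMaximalOrigin (Ω : Set ℂ) (d : ℂ → ℂ) (u : ℂ) (y α : ℝ) : Prop :=
  ((∀ x, IsCovered Ω d u y x) ∧ α = 0) ∨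
    (¬ (∀ x, IsCovered Ω d u y x) ∧ (rayOrigins Ω d u y).Nonempty ∧ α = sInf (rayOrigins Ω d u y))

/-- The half-lines into which the half-lines of the field merge, as pairs of an origin and a
direction. -/
def maximalHalfLines (Ω : Set ℂ) (d : ℂ → ℂ) : Set (ℂ × ℂ) :=
  {p | ‖p.2‖ = 1 ∧ ∃ y α, IsMaximalOrigin Ω d p.2 y α ∧ p.1 = linePoint p.2 y α}

theorem isCovered_neg_iff : IsCovered Ω d (-u) (-y) (-x) ↔ IsCovered Ω d u y x := by
  rw [IsCovered, IsCovered, neg_neg, neg_neg, neg_neg, or_comm]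

theorem forall_isCovered_neg_iff : (∀ x, IsCovered Ω d (-u) (-y) x) ↔ ∀ x, IsCovered Ω d u y x :=
  ⟨fun h x => isCovered_neg_iff.1 (h (-x)), fun h x => by
    rw [← neg_neg x]
    exact isCovered_neg_iff.2 (h (-x))⟩

theorem IsCovered.exists_mem_openHalfLine (h : IsCovered Ω d u y x) :
    ∃ w ∉ Ω, linePoint u y x ∈ openHalfLine w (d w) ∧ (d w = u ∨ d w = -u) := by
  rcases h with ⟨a, ⟨haΩ, hda⟩, hax⟩ | ⟨a, ⟨haΩ, hda⟩, hax⟩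
  · refine ⟨_, haΩ, ?_, .inl hda⟩
    rw [hda]
    exact mem_openHalfLine_linePoint hax
  · refine ⟨_, haΩ, ?_, .inr hda⟩
    rw [hda, ← linePoint_neg u y x]
    exact mem_openHalfLine_linePoint hax

namespace IsMaximalOrigin

theorem isCovered (h : IsMaximalOrigin Ω d u y α) (hx : α < x) : IsCovered Ω d u y x := by
  rcases h with ⟨hfull, -⟩ | ⟨-, hne, rfl⟩
  · exact hfull x
  · exact .inl (exists_lt_of_csInf_lt hne hx)

theorem unique {α' : ℝ} (h : IsMaximalOrigin Ω d u y α) (h' : IsMaximalOrigin Ω d u y α') :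
    α = α' := by
  rcases h with ⟨hfull, rfl⟩ | ⟨hfull, -, rfl⟩ <;> rcases h' with ⟨hfull', rfl⟩ | ⟨hfull', -, rfl⟩
  · rfl
  · exact absurd hfull hfull'
  · exact absurd hfull' hfull
  · rfl

-- Two overlapping opposite half-lines would cover their whole line.
theorem neg_le_of_neg {α' : ℝ} (h : IsMaximalOrigin Ω d u y α)
    (h' : IsMaximalOrigin Ω d (-u) (-y) α') : -α' ≤ α := by
  by_contra! hlt
  obtain ⟨x, hx, hx'⟩ := exists_between hlt
  rcases h with ⟨hfull, rfl⟩ | ⟨hfull, hne, rfl⟩ <;>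
    rcases h' with ⟨hfull', rfl⟩ | ⟨hfull', hne', rfl⟩
  · linarith
  · exact hfull' (forall_isCovered_neg_iff.2 hfull)
  · exact hfull (forall_isCovered_neg_iff.1 hfull')
  · obtain ⟨a, ha, hax⟩ := exists_lt_of_csInf_lt hne hx
    obtain ⟨b, hb, hbx⟩ := exists_lt_of_csInf_lt hne' (lt_neg.1 hx')
    refine hfull fun x₀ => ?_
    rcases lt_or_ge a x₀ with hax₀ | hax₀
    · exact .inl ⟨a, ha, hax₀⟩
    · exact .inr ⟨b, hb, by linarith⟩

end IsMaximalOrigin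

theorem exists_mem_openHalfLine_of_mem_maximalHalfLines {p : ℂ × ℂ} {z : ℂ}
    (hp : p ∈ maximalHalfLines Ω d) (hz : z ∈ openHalfLine p.1 p.2) :
    ∃ w ∉ Ω, z ∈ openHalfLine w (d w) ∧ (d w = p.2 ∨ d w = -p.2) := by
  obtain ⟨-, y, α, hα, hp1⟩ := hp
  rw [hp1] at hz
  obtain ⟨x, hx, rfl⟩ := exists_eq_linePoint_of_mem_openHalfLine hz
  exact (hα.isCovered hx).exists_mem_openHalfLine

namespace IsRayField

theorem exists_mem_maximalHalfLines (hd : IsRayField Ω d) {w : ℂ} (hw : w ∉ Ω) :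
    ∃ p ∈ maximalHalfLines Ω d, w ∈ closedHalfLine p.1 p.2 := by
  have hu := hd.norm_eq_one w hw
  obtain ⟨y, x, hwx⟩ := exists_eq_linePoint hu w
  have hmem : x ∈ rayOrigins Ω d (d w) y := by
    rw [rayOrigins, mem_ofPred, ← hwx]
    exact ⟨hw, rfl⟩
  by_cases hfull : ∀ x, IsCovered Ω d (d w) y x
  · rcases le_total 0 x with hx | hx
    · refine ⟨(linePoint (d w) y 0, d w), ⟨hu, y, 0, .inl ⟨hfull, rfl⟩, rfl⟩, ?_⟩
      have hwmem := mem_closedHalfLine_linePoint (u := d w) (y := y) hx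
      rwa [← hwx] at hwmem
    · refine ⟨(linePoint (-d w) (-y) 0, -d w), ⟨by rwa [norm_neg], -y, 0,
        .inl ⟨forall_isCovered_neg_iff.2 hfull, rfl⟩, rfl⟩, ?_⟩
      have hwmem := mem_closedHalfLine_linePoint (u := -d w) (y := -y) (neg_nonneg.2 hx)
      rwa [linePoint_neg, ← hwx] at hwmem
  · have hbdd : BddBelow (rayOrigins Ω d (d w) y) := by
      by_contra hbdd
      exact hfull fun x => .inl (not_bddBelow_iff.1 hbdd x)
    refine ⟨(linePoint (d w) y (sInf (rayOrigins Ω d (d w) y)), d w),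
      ⟨hu, y, _, .inr ⟨hfull, ⟨x, hmem⟩, rfl⟩, rfl⟩, ?_⟩
    have hwmem := mem_closedHalfLine_linePoint (u := d w) (y := y) (csInf_le hbdd hmem)
    rwa [← hwx] at hwmem

theorem closedHalfLine_subset_compl (hd : IsRayField Ω d) (hΩ : IsOpen Ω) {p : ℂ × ℂ}
    (hp : p ∈ maximalHalfLines Ω d) : closedHalfLine p.1 p.2 ⊆ Ωᶜ := by
  refine (closedHalfLine_subset_closure_openHalfLine _ _).trans
    (closure_minimal (fun z hz => ?_) hΩ.isClosed_compl)
  obtain ⟨w, hw, hzw, -⟩ := exists_mem_openHalfLine_of_mem_maximalHalfLines hp hz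
  exact hd.closedHalfLine_subset w hw (openHalfLine_subset_closedHalfLine _ _ hzw)

theorem im_conj_mul_eq_zero (hd : IsRayField Ω d) {p q : ℂ × ℂ} {z : ℂ}
    (hp : p ∈ maximalHalfLines Ω d) (hq : q ∈ maximalHalfLines Ω d)
    (hzp : z ∈ openHalfLine p.1 p.2) (hzq : z ∈ openHalfLine q.1 q.2) :
    (conj p.2 * q.2).im = 0 := by
  obtain ⟨w, hw, hzw, hdw⟩ := exists_mem_openHalfLine_of_mem_maximalHalfLines hp hzp
  obtain ⟨w', hw', hzw', hdw'⟩ := exists_mem_openHalfLine_of_mem_maximalHalfLines hq hzq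
  have him : (conj (d w) * d w').im = 0 := by
    by_contra hne
    exact disjoint_left.1 (hd.disjoint w hw w' hw' hne) hzw hzw'
  rcases hdw with h | h <;> rcases hdw' with h' | h' <;> rw [h, h'] at him <;>
    simpa only [map_neg, neg_mul, mul_neg, neg_im, neg_eq_zero, neg_neg] using him

theorem eq_of_mem_openHalfLine (hd : IsRayField Ω d) {p q : ℂ × ℂ} {z : ℂ}
    (hp : p ∈ maximalHalfLines Ω d) (hq : q ∈ maximalHalfLines Ω d)
    (hzp : z ∈ openHalfLine p.1 p.2) (hzq : z ∈ openHalfLine q.1 q.2) : p = q := by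
  have hparallel := hd.im_conj_mul_eq_zero hp hq hzp hzq
  obtain ⟨hu, y, α, hα, hp1⟩ := hp
  obtain ⟨hu', y', α', hα', hq1⟩ := hq
  rw [hp1] at hzp
  rw [hq1] at hzq
  obtain ⟨x, hx, rfl⟩ := exists_eq_linePoint_of_mem_openHalfLine hzp
  obtain ⟨x', hx', heq⟩ := exists_eq_linePoint_of_mem_openHalfLine hzq
  rcases eq_or_eq_neg_of_im_conj_mul_eq_zero hu hu' hparallel with hdir | hdir
  · rw [hdir] at heq hα' hq1
    obtain ⟨rfl, -⟩ := linePoint_injective hu heq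
    exact Prod.ext (by rw [hp1, hq1, hα.unique hα']) hdir.symm
  · rw [hdir, ← linePoint_neg p.2 y x] at heq
    obtain ⟨rfl, rfl⟩ := linePoint_injective (by rwa [norm_neg]) heq
    rw [hdir] at hα'
    linarith [hα.neg_le_of_neg hα']

theorem isCloseToConvexSet (hd : IsRayField Ω d) (hΩ : IsOpen Ω) : IsCloseToConvexSet Ω := by
  refine ⟨maximalHalfLines Ω d, fun p hp => hp.1, Subset.antisymm (fun w hw => ?_)
    (iUnion₂_subset fun p hp => hd.closedHalfLine_subset_compl hΩ hp), fun p hp q hq hne =>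
      disjoint_left.2 fun z hzp hzq => hne (hd.eq_of_mem_openHalfLine hp hq hzp hzq)⟩
  obtain ⟨p, hp, hwp⟩ := hd.exists_mem_maximalHalfLines hw
  exact mem_biUnion hp hwp

end IsRayField

end MaximalHalfLines

theorem HasOutwardCircles.isCloseToConvexOnDisk {f : ℂ → ℂ} (hf : HasOutwardCircles f) :
    IsCloseToConvexOnDisk f :=
  let ⟨_, hd⟩ := hf.exists_isRayField
  ⟨hf.injOn, hd.isCloseToConvexSet (hf.isOpen_image isOpen_ball Subset.rfl)⟩

section LocalUnivalence

theorem eq_one_of_injOn_pow {X : Type*} [TopologicalSpace X] {ψ : X → ℂ} {x : X} {n : ℕ}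
    (hn : n ≠ 0) (hψ : Filter.map ψ (𝓝 x) = 𝓝 0) {U : Set X} (hU : U ∈ 𝓝 x)
    (hinj : InjOn (fun y => ψ y ^ n) U) : n = 1 := by
  set ζ : ℂ := exp (2 * π * I / n)
  have hζ : IsPrimitiveRoot ζ n := isPrimitiveRoot_exp n hn
  have hU' : ψ '' U ∈ 𝓝 (0 : ℂ) := hψ ▸ Filter.image_mem_map hU
  have hζU : ∀ᶠ v in 𝓝 (0 : ℂ), ζ * v ∈ ψ '' U := by
    have : Filter.Tendsto (fun v : ℂ => ζ * v) (𝓝 0) (𝓝 0) := by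
      simpa only [mul_zero] using (continuous_const_mul ζ).tendsto 0
    exact this.eventually hU'
  obtain ⟨v, ⟨⟨y₁, hy₁, hv₁⟩, y₂, hy₂, hv₂⟩, hv⟩ :=
    ((Filter.Eventually.and hU' hζU).filter_mono nhdsWithin_le_nhds |>.and
      (self_mem_nhdsWithin : ∀ᶠ v in 𝓝[≠] (0 : ℂ), v ∈ ({0}ᶜ : Set ℂ))).exists
  have hpow : ψ y₁ ^ n = ψ y₂ ^ n := by rw [hv₁, hv₂, mul_pow, hζ.pow_eq_one, one_mul]
  obtain rfl : y₁ = y₂ := hinj hy₁ hy₂ hpow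
  have hζ_one : ζ = 1 := mul_right_cancel₀ hv (by rw [← hv₂, hv₁, one_mul])
  rw [hζ_one] at hζ
  exact hζ.unique .one

theorem exists_eventually_eq_add_mul_pow {h : ℂ → ℂ} {z : ℂ} (hh : AnalyticAt ℂ h z)
    (hconst : ¬ ∀ᶠ w in 𝓝 z, h w = h z) :
    ∃ n ≠ 0, ∃ c ≠ 0, ∃ ψ : ℂ → ℂ, HasStrictDerivAt ψ 1 z ∧ ψ z = 0 ∧
      ∀ᶠ w in 𝓝 z, h w = h z + c * ψ w ^ n := by
  obtain ⟨n, g, hg, hgz, heq⟩ :=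
    (hh.sub analyticAt_const).exists_eventuallyEq_pow_smul_nonzero_iff.2
      fun hev => hconst (hev.mono fun w hw => sub_eq_zero.1 hw)
  have hn : n ≠ 0 := by
    rintro rfl
    have := heq.self_of_nhds
    simp only [Pi.sub_apply, sub_self, pow_zero, one_smul] at this
    exact hgz this.symm
  have hn' : (n : ℂ) ≠ 0 := Nat.cast_ne_zero.2 hn
  set ρ : ℂ → ℂ := fun w => exp (log (g w / g z) / n)
  have hρz : ρ z = 1 := by simp only [ρ, div_self hgz, log_one, zero_div, Complex.exp_zero]
  have hρ : AnalyticAt ℂ ρ z :=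
    (((hg.fun_div analyticAt_const hgz).clog
      (by rw [div_self hgz]; exact one_mem_slitPlane)).fun_div analyticAt_const hn').cexp
  refine ⟨n, hn, g z, hgz, fun w => (w - z) * ρ w, ?_, by simp only [sub_self, zero_mul], ?_⟩
  · simpa [hρz] using
      HasStrictDerivAt.fun_mul ((hasStrictDerivAt_id z).sub_const z) hρ.hasStrictDerivAt
  · filter_upwards [heq, hg.continuousAt.eventually_ne hgz] with w hw hgw
    have hρw : ρ w ^ n = g w / g z := by
      rw [← exp_nat_mul, mul_div_cancel₀ _ hn', exp_log (div_ne_zero hgw hgz)]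
    rw [Pi.sub_apply, smul_eq_mul] at hw
    rw [mul_pow, hρw, mul_left_comm, mul_div_cancel₀ _ hgz, ← hw, add_sub_cancel]

theorem deriv_ne_zero_of_injOn {h : ℂ → ℂ} {z : ℂ} (hh : AnalyticAt ℂ h z) {U : Set ℂ}
    (hU : U ∈ 𝓝 z) (hinj : InjOn h U) : deriv h z ≠ 0 := by
  have hconst : ¬ ∀ᶠ w in 𝓝 z, h w = h z := by
    intro hev
    obtain ⟨w, ⟨hw, hwU⟩, hwz⟩ :=
      (((hev.and hU).filter_mono nhdsWithin_le_nhds).and self_mem_nhdsWithin :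
        ∀ᶠ w in 𝓝[≠] z, _).exists
    exact hwz (hinj hwU (mem_of_mem_nhds hU) hw)
  obtain ⟨n, hn, c, hc, ψ, hψ, hψz, heq⟩ := exists_eventually_eq_add_mul_pow hh hconst
  obtain rfl : n = 1 := by
    refine eq_one_of_injOn_pow hn (hψz ▸ hψ.map_nhds_eq one_ne_zero)
      (Filter.inter_mem hU heq) fun w₁ hw₁ w₂ hw₂ hpow => hinj hw₁.1 hw₂.1 ?_
    rw [hw₁.2, hw₂.2]
    exact congrArg (fun v => h z + c * v) hpow
  have hderiv : HasDerivAt h (c * 1) z := by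
    refine ((hψ.hasDerivAt.const_mul c).const_add (h z)).congr_of_eventuallyEq (heq.mono ?_)
    intro w hw
    rw [hw, pow_one]
  rwa [hderiv.deriv, mul_one]

end LocalUnivalence

section HarmonicMap

variable {h g : ℂ → ℂ} {a A B : ℂ}

theorem hasStrictFDerivAt_add_conj (hh : HasStrictDerivAt h A a) (hg : HasStrictDerivAt g B a) :
    ∃ L : ℂ →L[ℝ] ℂ, (∀ v, L v = A * v + conj (B * v)) ∧
      HasStrictFDerivAt (fun z => h z + conj (g z)) L a := by
  refine ⟨_, fun v => ?_, (hh.hasStrictFDerivAt.restrictScalars ℝ).add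
    ((conjCLE.toContinuousLinearMap.hasStrictFDerivAt (x := g a)).comp a
      (hg.hasStrictFDerivAt.restrictScalars ℝ))⟩
  simp [mul_comm]

theorem isPositiveZero_add_conj (hh : HasStrictDerivAt h A a) (hg : HasStrictDerivAt g B a)
    (hBA : ‖B‖ < ‖A‖) :
    IsPositiveZero (fun z => h z + conj (g z) - (h a + conj (g a))) a := by
  obtain ⟨L, hL, hderiv⟩ := hasStrictFDerivAt_add_conj hh hg
  have hA : 0 < ‖A‖ := (norm_nonneg _).trans_lt hBA
  obtain ⟨k, hBk, hk1⟩ := exists_between ((div_lt_one hA).2 hBA)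
  rw [div_lt_iff₀ hA] at hBk
  refine ⟨A, norm_pos_iff.1 hA, k, hk1, ?_⟩
  filter_upwards [hderiv.hasFDerivAt.isLittleO.bound (sub_pos.2 hBk)] with z hz
  rw [hL] at hz
  calc
    _ = ‖(h z + conj (g z) - (h a + conj (g a)) - (A * (z - a) + conj (B * (z - a))))
          + conj (B * (z - a))‖ := by congr 1; ring
    _ ≤ (k * ‖A‖ - ‖B‖) * ‖z - a‖ + ‖B‖ * ‖z - a‖ := by
      refine (norm_add_le _ _).trans (add_le_add hz ?_)
      rw [RCLike.norm_conj, norm_mul]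
    _ = k * ‖A * (z - a)‖ := by rw [norm_mul]; ring

theorem map_nhds_add_conj (hh : HasStrictDerivAt h A a) (hg : HasStrictDerivAt g B a)
    (hBA : ‖B‖ < ‖A‖) :
    Filter.map (fun z => h z + conj (g z)) (𝓝 a) = 𝓝 (h a + conj (g a)) := by
  obtain ⟨L, hL, hderiv⟩ := hasStrictFDerivAt_add_conj hh hg
  have hinj : Function.Injective (L : ℂ →ₗ[ℝ] ℂ) := by
    rw [← LinearMap.ker_eq_bot, LinearMap.ker_eq_bot']
    intro v hv
    have hv : A * v + conj (B * v) = 0 := by rw [← hL]; exact hv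
    by_contra hv0
    have hnorm := congrArg norm (eq_neg_of_add_eq_zero_left hv)
    rw [norm_neg, RCLike.norm_conj, norm_mul, norm_mul] at hnorm
    exact hBA.ne' (mul_right_cancel₀ (norm_ne_zero_iff.2 hv0) hnorm)
  exact hderiv.map_nhds_eq_of_surj
    (LinearMap.range_eq_top.2 (LinearMap.injective_iff_surjective.1 hinj))

theorem im_add_conj_mul_exp_pos {α β : ℝ} (hA : A = ‖A‖ * exp (α * I))
    (hBA : ‖B‖ < Real.cos (α - β) * ‖A‖) :
    0 < ((A * I + conj (B * I)) * exp ((-β : ℝ) * I)).im := by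
  have hre_A : (A * exp ((-β : ℝ) * I)).re = Real.cos (α - β) * ‖A‖ := by
    rw [hA, mul_assoc, ← Complex.exp_add, ← add_mul, ← ofReal_add, ← sub_eq_add_neg,
      re_ofReal_mul, exp_ofReal_mul_I_re, ← hA, mul_comm]
  have hre_B : (conj B * exp ((-β : ℝ) * I)).re ≤ ‖B‖ := by
    refine (re_le_norm _).trans_eq ?_
    rw [norm_mul, norm_exp_ofReal_mul_I, RCLike.norm_conj, mul_one]
  have hfactor : (A * I + conj (B * I)) * exp ((-β : ℝ) * I)
      = I * (A * exp ((-β : ℝ) * I) - conj B * exp ((-β : ℝ) * I)) := by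
    rw [map_mul, conj_I]
    ring
  rw [hfactor, I_mul_im, sub_re]
  linarith

end HarmonicMap

section MonotoneAngle

variable {H : ℝ → ℝ} {T a : ℝ}

theorem exists_eq_add_nat_mul {x : ℝ} (hT : 0 < T) (hx : 0 ≤ x) :
    ∃ y ∈ Icc 0 T, ∃ k : ℕ, x = y + k * T := by
  have hlower := Nat.floor_le (div_nonneg hx hT.le)
  have hupper := Nat.lt_floor_add_one (x / T)
  rw [le_div_iff₀ hT] at hlower
  rw [div_lt_iff₀ hT] at hupper
  exact ⟨x - ⌊x / T⌋₊ * T, ⟨by linarith, by linarith⟩, ⌊x / T⌋₊, by ring⟩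

theorem le_add_nat_mul_period (ha : 0 ≤ a) (hper : ∀ θ, H (θ + T) = H θ + a) (θ : ℝ) (k : ℕ) :
    H θ ≤ H (θ + k * T) := by
  have := AddConstMapClass.map_add_nsmul (AddConstMap.mk H hper) θ k
  simp only [AddConstMap.coe_mk, nsmul_eq_mul] at this
  rw [this]
  exact le_add_of_nonneg_right (by positivity)

theorem exists_monotone_abs_sub_le (hT : 0 < T) (ha : 0 ≤ a) (hH : Continuous H)
    (hper : ∀ θ, H (θ + T) = H θ + a) {c : ℝ} (hdrop : ∀ θ₁ θ₂, θ₁ ≤ θ₂ → H θ₁ - c ≤ H θ₂) :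
    ∃ s : ℝ → ℝ, Continuous s ∧ Monotone s ∧ (∀ θ, s (θ + T) = s θ + a) ∧
      ∀ θ, |H θ - s θ| ≤ c / 2 := by
  -- By quasiperiodicity the supremum of `H` over `(-∞, θ]` is attained on `[θ - T, θ]`.
  set S : ℝ → ℝ := fun θ => sSup ((fun x => H (θ - x)) '' Icc 0 T)
  have hS_cont : Continuous S := isCompact_Icc.continuous_sSup
    (f := fun θ x => H (θ - x)) (hH.comp continuous_sub)
  have le_S (t θ : ℝ) (h : t ≤ θ) : H t ≤ S θ := by
    obtain ⟨x, hx, k, hk⟩ := exists_eq_add_nat_mul hT (sub_nonneg.2 h)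
    have hbdd : BddAbove ((fun x => H (θ - x)) '' Icc 0 T) :=
      isCompact_Icc.bddAbove_image (hH.comp (continuous_const.sub continuous_id)).continuousOn
    calc
      H t ≤ H (t + k * T) := le_add_nat_mul_period ha hper t k
      _ = H (θ - x) := by congr 1; linarith
      _ ≤ S θ := le_csSup hbdd (mem_image_of_mem _ hx)
  have S_le (θ b : ℝ) (hb : ∀ t ≤ θ, H t ≤ b) : S θ ≤ b := by
    refine csSup_le ((nonempty_Icc.2 hT.le).image _) ?_
    rintro _ ⟨x, hx, rfl⟩
    exact hb _ (sub_le_self θ hx.1)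
  refine ⟨fun θ => S θ - c / 2, hS_cont.sub continuous_const, fun θ₁ θ₂ h => ?_, fun θ => ?_,
    fun θ => ?_⟩
  · exact sub_le_sub_right (S_le _ _ fun t ht => le_S t θ₂ (ht.trans h)) _
  · have hle : S (θ + T) ≤ S θ + a := S_le _ _ fun t ht => by
      have hshift := hper (t - T)
      rw [sub_add_cancel] at hshift
      linarith [le_S (t - T) θ (by linarith)]
    have hge : S θ ≤ S (θ + T) - a := S_le _ _ fun t ht => by
      linarith [le_S (t + T) (θ + T) (by linarith), hper t]
    change S (θ + T) - c / 2 = S θ - c / 2 + a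
    linarith
  · have hle := le_S θ θ le_rfl
    have hge : S θ ≤ H θ + c := S_le _ _ fun t ht => by linarith [hdrop t θ ht]
    exact abs_le.2 ⟨by linarith, by linarith⟩

variable {D : ℝ → ℝ}

theorem periodic_of_hasDerivAt (hHD : ∀ θ, HasDerivAt H (D θ) θ)
    (hper : ∀ θ, H (θ + T) = H θ + a) : Function.Periodic D T := fun θ =>
  ((hHD (θ + T)).comp_add_const θ T).unique (by simpa only [hper] using (hHD θ).add_const a)

theorem sub_le_of_integral_abs_le (hT : 0 < T) (ha : 0 ≤ a) (hHD : ∀ θ, HasDerivAt H (D θ) θ)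
    (hD : Continuous D) (hper : ∀ θ, H (θ + T) = H θ + a) {V : ℝ}
    (hV : ∫ θ in (0 : ℝ)..T, |D θ| ≤ V) {θ₁ θ₂ : ℝ} (h : θ₁ ≤ θ₂) :
    H θ₁ - (V - a) / 2 ≤ H θ₂ := by
  have abs_sub_le_integral {x y : ℝ} (hxy : x ≤ y) : |H y - H x| ≤ ∫ θ in x..y, |D θ| := by
    rw [← intervalIntegral.integral_eq_sub_of_hasDerivAt (fun θ _ => hHD θ)
      (hD.intervalIntegrable x y)]
    exact intervalIntegral.abs_integral_le_integral_abs (μ := MeasureTheory.volume) hxy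
  have hperiod : ∫ θ in θ₁..(θ₁ + T), |D θ| ≤ V := by
    have habs : Function.Periodic (fun θ => |D θ|) T :=
      (periodic_of_hasDerivAt hHD hper).comp fun x : ℝ => |x|
    rwa [habs.intervalIntegral_add_eq θ₁ 0, zero_add]
  -- A drop over `[θ₁, t]` has to be made up for over `[t, θ₁ + T]`.
  have hdrop (t : ℝ) (h₁ : θ₁ ≤ t) (h₂ : t ≤ θ₁ + T) : H θ₁ - (V - a) / 2 ≤ H t := by
    have hsplit := intervalIntegral.integral_add_adjacent_intervals (μ := MeasureTheory.volume)
      (hD.abs.intervalIntegrable θ₁ t) (hD.abs.intervalIntegrable t (θ₁ + T))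
    linarith [abs_sub_le_integral h₁, abs_sub_le_integral h₂, neg_abs_le (H t - H θ₁),
      le_abs_self (H (θ₁ + T) - H t), hper θ₁]
  obtain ⟨x, hx, k, hk⟩ := exists_eq_add_nat_mul hT (sub_nonneg.2 h)
  calc
    H θ₁ - (V - a) / 2 ≤ H (θ₁ + x) := hdrop _ (by linarith [hx.1]) (by linarith [hx.2])
    _ ≤ H (θ₁ + x + k * T) := le_add_nat_mul_period ha hper _ k
    _ = H θ₂ := by congr 1; linarith

end MonotoneAngle

section TangentAngle

variable {f : ℂ → ℂ} {R r : ℝ}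

theorem exists_log_of_ne_zero {c : ℂ} (hR : 0 < R) (hf : DifferentiableOn ℂ f (ball c R))
    (hne : ∀ z ∈ ball c R, f z ≠ 0) :
    ∃ L : ℂ → ℂ, (∀ z ∈ ball c R, HasDerivAt L (deriv f z / f z) z) ∧
      ∀ z ∈ ball c R, exp (L z) = f z := by
  have hc : c ∈ ball c R := mem_ball_self hR
  obtain ⟨L, hLc, hL⟩ :=
    ((hf.deriv isOpen_ball).div hf hne).isExactOn_ball.with_val_at c (log (f c))
  have hderiv : ∀ w ∈ ball c R, HasDerivAt (fun w => f w * exp (-L w)) 0 w := by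
    intro w hw
    refine ((hf.differentiableAt (isOpen_ball.mem_nhds hw)).hasDerivAt.fun_mul
      (hL w hw).fun_neg.cexp).congr_deriv ?_
    have := hne w hw
    rw [Pi.div_apply]
    field_simp
    ring
  refine ⟨L, hL, fun z hz => ?_⟩
  have hconst := isOpen_ball.is_const_of_deriv_eq_zero (convex_ball c R).isPreconnected
    (fun w hw => (hderiv w hw).differentiableAt.differentiableWithinAt)
    (fun w hw => (hderiv w hw).deriv) hz hc
  simp only [hLc] at hconst
  rw [Complex.exp_neg, Complex.exp_neg, exp_log (hne c hc), mul_inv_cancel₀ (hne c hc)] at hconst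
  exact ((mul_inv_eq_one₀ (exp_ne_zero _)).1 hconst).symm

theorem circleMap_zero_mem_ball (hr : 0 ≤ r) (hrR : r < R) (θ : ℝ) :
    circleMap 0 r θ ∈ ball (0 : ℂ) R := by
  rwa [mem_ball_zero_iff, norm_circleMap_zero, abs_of_nonneg hr]

theorem exists_angle_circleMap_mul (hf : DifferentiableOn ℂ f (ball 0 R))
    (hne : ∀ z ∈ ball (0 : ℂ) R, f z ≠ 0) (hr : 0 < r) (hrR : r < R) :
    ∃ H : ℝ → ℝ,
      (∀ θ, HasDerivAt H
        (1 + circleMap 0 r θ * deriv f (circleMap 0 r θ) / f (circleMap 0 r θ)).re θ) ∧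
      (∀ θ, H (θ + 2 * π) = H θ + 2 * π) ∧
      ∀ θ, circleMap 0 r θ * f (circleMap 0 r θ)
        = ‖circleMap 0 r θ * f (circleMap 0 r θ)‖ * exp (H θ * I) := by
  obtain ⟨L, hL, hexp⟩ := exists_log_of_ne_zero (hr.trans hrR) hf hne
  have hmem := circleMap_zero_mem_ball hr.le hrR
  refine ⟨fun θ => θ + (L (circleMap 0 r θ)).im, fun θ => ?_, fun θ => ?_, fun θ => ?_⟩
  · refine ((hasDerivAt_id θ).fun_add (imCLM.hasFDerivAt.comp_hasDerivAt θ
      ((hL _ (hmem θ)).comp_of_eq θ (hasDerivAt_circleMap 0 r θ) rfl))).congr_deriv ?_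
    rw [imCLM_apply, ← mul_assoc, mul_I_im, add_re, one_re, div_mul_eq_mul_div,
      mul_comm (deriv f _)]
  · simp only [periodic_circleMap 0 r θ]
    ring
  · rw [norm_mul, norm_circleMap_zero, abs_of_pos hr, ← hexp _ (hmem θ), norm_exp]
    conv_lhs => rw [← re_add_im (L (circleMap 0 r θ)), Complex.exp_add]
    nth_rw 1 [circleMap_zero]
    push_cast
    rw [add_mul, Complex.exp_add]
    ring

theorem exists_monotone_angle_circleMap_mul (hf : DifferentiableOn ℂ f (ball 0 R))
    (hne : ∀ z ∈ ball (0 : ℂ) R, f z ≠ 0) (hr : 0 < r) (hrR : r < R) {V : ℝ}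
    (hV : ∫ θ in (0 : ℝ)..(2 * π),
      |(1 + circleMap 0 r θ * deriv f (circleMap 0 r θ) / f (circleMap 0 r θ)).re| ≤ V) :
    ∃ H s : ℝ → ℝ, Continuous s ∧ Monotone s ∧ (∀ θ, s (θ + 2 * π) = s θ + 2 * π) ∧
      (∀ θ, |H θ - s θ| ≤ (V - 2 * π) / 4) ∧
      ∀ θ, circleMap 0 r θ * f (circleMap 0 r θ)
        = ‖circleMap 0 r θ * f (circleMap 0 r θ)‖ * exp (H θ * I) := by
  obtain ⟨H, hderiv, hper, hpolar⟩ := exists_angle_circleMap_mul hf hne hr hrR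
  have hmem := circleMap_zero_mem_ball hr.le hrR
  have hcont {F : ℂ → ℂ} (hF : DifferentiableOn ℂ F (ball 0 R)) :
      Continuous fun θ => F (circleMap 0 r θ) :=
    hF.continuousOn.comp_continuous (continuous_circleMap 0 r) hmem
  have hderiv_cont : Continuous fun θ =>
      (1 + circleMap 0 r θ * deriv f (circleMap 0 r θ) / f (circleMap 0 r θ)).re :=
    continuous_re.comp (continuous_const.add (((continuous_circleMap 0 r).mul
      (hcont (hf.deriv isOpen_ball))).div (hcont hf) fun θ => hne _ (hmem θ)))
  obtain ⟨s, hs_cont, hs_mono, hs_add, hHs⟩ := exists_monotone_abs_sub_le Real.two_pi_pos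
    Real.two_pi_pos.le (continuous_iff_continuousAt.2 fun θ => (hderiv θ).continuousAt) hper
    fun _ _ => sub_le_of_integral_abs_le Real.two_pi_pos Real.two_pi_pos.le hderiv hderiv_cont
      hper hV
  exact ⟨H, s, hs_cont, hs_mono, hs_add, fun θ => (hHs θ).trans_eq (by ring), hpolar⟩

end TangentAngle

section HarmonicDisk

variable {h g : ℂ → ℂ}

theorem exists_outwardDirected_add_conj {R r : ℝ} (hh : DifferentiableOn ℂ h (ball 0 R))
    (hg : DifferentiableOn ℂ g (ball 0 R)) (hne : ∀ z ∈ ball (0 : ℂ) R, deriv h z ≠ 0)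
    (hr : 0 < r) (hrR : r < R) {V : ℝ} (hV : V ≤ 6 * π)
    (hrotation : ∫ θ in (0 : ℝ)..(2 * π), |(1 + circleMap 0 r θ *
      deriv (deriv h) (circleMap 0 r θ) / deriv h (circleMap 0 r θ)).re| ≤ V)
    (hlt : ∀ z ∈ ball (0 : ℂ) R, ‖deriv g z‖ < Real.cos ((V - 2 * π) / 4) * ‖deriv h z‖) :
    ∃ s, OutwardDirected (fun θ => h (circleMap 0 r θ) + conj (g (circleMap 0 r θ))) s := by
  obtain ⟨H, s, hs_cont, hs_mono, hs_add, hHs, hpolar⟩ :=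
    exists_monotone_angle_circleMap_mul (hh.deriv isOpen_ball) hne hr hrR hrotation
  refine ⟨s, fun θ => ?_, hs_cont, hs_mono, hs_add⟩
  set z := circleMap 0 r θ with hz_def
  have hz : z ∈ ball (0 : ℂ) R := circleMap_zero_mem_ball hr.le hrR θ
  have hderiv {F : ℂ → ℂ} (hF : DifferentiableOn ℂ F (ball 0 R)) :
      HasDerivAt (fun θ => F (circleMap 0 r θ)) (z * deriv F z * I) θ := by
    refine ((hF.differentiableAt (isOpen_ball.mem_nhds hz)).hasDerivAt.comp_of_eq θ
      (hasDerivAt_circleMap 0 r θ) rfl).congr_deriv ?_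
    rw [← hz_def]
    ring
  refine ⟨_, (hderiv hh).add
    (conjCLE.toContinuousLinearMap.hasFDerivAt.comp_hasDerivAt θ (hderiv hg)),
    im_add_conj_mul_exp_pos (hpolar θ) ?_⟩
  have hcos : Real.cos ((V - 2 * π) / 4) ≤ Real.cos (H θ - s θ) := by
    rw [← Real.cos_abs (H θ - s θ)]
    exact Real.cos_le_cos_of_nonneg_of_le_pi (abs_nonneg _) (by linarith) (hHs θ)
  have hz_pos : 0 < ‖z‖ := by rwa [norm_circleMap_zero, abs_of_pos hr]
  calc
    ‖z * deriv g z‖ = ‖z‖ * ‖deriv g z‖ := norm_mul _ _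
    _ < ‖z‖ * (Real.cos ((V - 2 * π) / 4) * ‖deriv h z‖) := by gcongr; exact hlt z hz
    _ ≤ ‖z‖ * (Real.cos (H θ - s θ) * ‖deriv h z‖) := by gcongr
    _ = Real.cos (H θ - s θ) * ‖z * deriv h z‖ := by rw [norm_mul, mul_left_comm]

theorem hasOutwardCircles_add_conj (hh : AnalyticOnNhd ℂ h (ball 0 1))
    (hg : AnalyticOnNhd ℂ g (ball 0 1)) (hne : ∀ z ∈ ball (0 : ℂ) 1, deriv h z ≠ 0)
    {V : ℝ} (hV : V ≤ 6 * π)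
    (hrotation : ∀ r : ℝ, 0 < r → r < 1 → ∫ θ in (0 : ℝ)..(2 * π), |(1 + circleMap 0 r θ *
      deriv (deriv h) (circleMap 0 r θ) / deriv h (circleMap 0 r θ)).re| ≤ V)
    (hlt : ∀ z ∈ ball (0 : ℂ) 1, ‖deriv g z‖ < Real.cos ((V - 2 * π) / 4) * ‖deriv h z‖) :
    HasOutwardCircles (fun z => h z + conj (g z)) := by
  have hlt_one (z : ℂ) (hz : z ∈ ball 0 1) : ‖deriv g z‖ < ‖deriv h z‖ :=
    (hlt z hz).trans_le (mul_le_of_le_one_left (norm_nonneg _) (Real.cos_le_one _))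
  exact
    { map_nhds := fun a ha =>
        map_nhds_add_conj (hh a ha).hasStrictDerivAt (hg a ha).hasStrictDerivAt (hlt_one a ha)
      isPositiveZero := fun a ha =>
        isPositiveZero_add_conj (hh a ha).hasStrictDerivAt (hg a ha).hasStrictDerivAt
          (hlt_one a ha)
      directed := fun r hr hr1 => exists_outwardDirected_add_conj hh.differentiableOn
        hg.differentiableOn hne hr hr1 hV (hrotation r hr hr1) hlt }

end HarmonicDisk

theorem BoundaryRotationClass.deriv_ne_zero {K : ℝ} {h : ℂ → ℂ} (hh : BoundaryRotationClass K h)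
    {z : ℂ} (hz : z ∈ ball (0 : ℂ) 1) : deriv h z ≠ 0 :=
  let ⟨_, hU, hinj⟩ := hh.locallyUnivalent z hz
  deriv_ne_zero_of_injOn (hh.analytic z hz) hU hinj

theorem mainTheorem2 (K δ : ℝ) (h g ω : ℂ → ℂ)
    (hδ0 : 0 ≤ δ) (hδ2 : δ ≤ 2) (hK2 : 2 ≤ K) (hK : K ≤ 4 - δ)
    (hh : BoundaryRotationClass K h)
    (hg : AnalyticOnNhd ℂ g (ball 0 1))
    (hω : ∀ z ∈ ball (0 : ℂ) 1, deriv g z = ω z * deriv h z)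
    (hω_lt : ∀ z ∈ ball (0 : ℂ) 1, ‖ω z‖ < Real.sin (δ * π / 4)) :
    IsCloseToConvexOnDisk (fun z => h z + conj (g z)) ∧
      IsUnivalentOnDisk (fun z => h z + conj (g z)) := by
  have hsin : Real.sin (δ * π / 4) ≤ Real.cos ((K * π - 2 * π) / 4) := by
    rw [← Real.cos_pi_div_two_sub]
    exact Real.cos_le_cos_of_nonneg_of_le_pi (by nlinarith [Real.pi_pos])
      (by nlinarith [Real.pi_pos]) (by nlinarith [Real.pi_pos])
  have hf : HasOutwardCircles (fun z => h z + conj (g z)) := by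
    refine hasOutwardCircles_add_conj hh.analytic hg (fun z => hh.deriv_ne_zero)
      (V := K * π) (by nlinarith [Real.pi_pos]) (fun r hr hr1 => ?_) fun z hz => ?_
    · simpa only [circleMap_zero] using hh.rotation_le r hr hr1
    · rw [hω z hz, norm_mul]
      exact mul_lt_mul_of_pos_right ((hω_lt z hz).trans_le hsin)
        (norm_pos_iff.2 (hh.deriv_ne_zero hz))
  exact ⟨hf.isCloseToConvexOnDisk, hf.injOn⟩
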